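/- **Setting.** Let $d,n\ge 1$, $\mathcal X\subset\mathbb R^n$, $\mathcal Y\subset\mathbb R$, $\alpha\in\mathbb R$, let $\pi$ be a probability measure on $\mathcal X\times\mathcal Y$, let $\gamma_*=4\lceil d/2\rceil+6$, and assume $\int |y|^{16\gamma_*}\,\pi(dx,dy)<\infty$. Let $\sigma_*:\mathbb R^d\times\mathcal X\to\mathbb R$ be $C^\infty$ in its first variable $w$, with $w$-derivatives of all orders (including $0$) continuous and bounded on $\mathbb R^d\times\mathcal X$ (this holds in particular when $\sigma_*\in C_b^\infty(\mathbb R^d\times\mathcal X)$). Let $\mu_0$ be a compactly supported probability measure on $\mathbb R^d$. For a function $f$ and a measure $\mu$ write $\langle f,\mu\rangle=\int f\,d\mu$; all gradients are in $w$. Let $\bar\mu=(\bar\mu_t)_{t\ge0}\in C(\mathbb R_+,\mathcal P_1(\mathbb R^d))$ (probability measures with finite first moment, Wasserstein distance $\mathsf W_1$) solve, for all $f\in C_b^\infty(\mathbb R^d)$ and $t\ge0$, $$\langle f,\bar\mu_t\rangle=\langle f,\mu_0\rangle+\int_0^t\int_{\mathcal X\times\mathcal Y}\alpha\,(y-\langle\sigma_*(\cdot,x),\bar\mu_s\rangle)\,\langle\nabla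 f\cdot\nabla\sigma_*(\cdot,x),\bar\mu_s\rangle\,\pi(dx,dy)\,ds .$$ (This is the equation of the mean-field limit of the empirical measures of the weights of a two-layer network trained by mini-batch SGD with learning rate $\alpha$ and Gaussian noise $\varepsilon/N^{\beta}$, $\beta>3/4$. The exponent $\beta$ enters neither this equation nor the fluctuation equation below.) For $J\in\mathbb N$, $b\ge0$ let $\mathcal H^{J,b}(\mathbb R^d)$ be the closure of $C_c^\infty(\mathbb R^d)$ for the norm $\|g\|^2=\sum_{|k|\le J}\int_{\mathbb R^d}\frac{|D^kg(x)|^2}{1+|x|^{2b}}\,dx$, let $\mathcal H^{-J,b}(\mathbb R^d)$ be its dual space, and write $\langle f,\Phi\rangle=\Phi[f]$. Let $J_0\ge 4\lceil d/2\rceil+8$ be an integer and $j_0=\lceil d/2\rceil+2$. Let $|B_\infty|$ be a random variable with values in $\{1,2,\dots\}$ (the limiting mini-batch size). A *G-process* is a process $\mathscr G$ with values in $C(\mathbb R_+,\mathcal H^{-J_0,j_0}(\mathbb R^d))$ such that for all $f_1,\dots,f_k\in\mathcal H^{J_0,j_0}(\mathbb R^d)$ the process $(\langle f_1,\mathscr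 G_t\rangle,\dots,\langle f_k,\mathscr G_t\rangle)_{t\ge 0}$ is square integrable with zero mean, has independent Gaussian increments, and satisfies, for $0\le s\le t$, $$\mathrm{Cov}(\langle f_i,\mathscr G_t\rangle,\langle f_j,\mathscr G_s\rangle)=\alpha^2\,\mathbf E\Big[\frac1{|B_\infty|}\Big]\int_0^s\mathrm{Cov}\big(\mathrm Q_v[f_i](x,y),\mathrm Q_v[f_j](x,y)\big)\,dv,$$ where $(x,y)\sim\pi$ and $\mathrm Q_v[f](x,y)=(y-\langle\sigma_*(\cdot,x),\bar\mu_v\rangle)\langle\nabla f\cdot\nabla\sigma_*(\cdot,x),\bar\mu_v\rangle$. Given a G-process $\mathscr G$, a $C(\mathbb R_+,\mathcal H^{-J_0+1,j_0}(\mathbb R^d))$-valued process $\eta$ on the same probability space *solves the limit fluctuation equation* if almost surely, for all $f\in\mathcal H^{J_0,j_0}(\mathbb R^d)$ and all $t\ge0$, $$\begin{aligned}\langle f,\eta_t\rangle-\langle f,\eta_0\rangle={}&\int_0^t\int_{\mathcal X\times\mathcal Y}\alpha\,(y-\langle\sigma_*(\cdot,x),\bar\mu_s\rangle)\,\langle\nabla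 f\cdot\nabla\sigma_*(\cdot,x),\eta_s\rangle\,\pi(dx,dy)\,ds\\&-\int_0^t\int_{\mathcal X\times\mathcal Y}\alpha\,\langle\sigma_*(\cdot,x),\eta_s\rangle\,\langle\nabla f\cdot\nabla\sigma_*(\cdot,x),\bar\mu_s\rangle\,\pi(dx,dy)\,ds+\langle f,\mathscr G_t\rangle .\end{aligned}$$ **Proposition.** Strong (pathwise) uniqueness holds for the limit fluctuation equation: on any probability space, given an $\mathcal H^{-J_0+1,j_0}(\mathbb R^d)$-valued random variable $\nu$ and a G-process $\mathscr G$, if $\eta^1,\eta^2$ are two $C(\mathbb R_+,\mathcal H^{-J_0+1,j_0}(\mathbb R^d))$-valued processes that solve the equation with this $\mathscr G$ and satisfy $\eta^1_0=\nu=\eta^2_0$ almost surely, then almost surely $\eta^1_t=\eta^2_t$ for all $t\ge0$. -/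

import Mathlib

open MeasureTheory ProbabilityTheory Filter Topology
open scoped NNReal ENNReal

noncomputable section

/-! ### Weighted Sobolev spaces -/

/-- The Euclidean space `ℝ^d`. -/
abbrev Eucl (d : ℕ) : Type := EuclideanSpace ℝ (Fin d)

/-- `⌈d / 2⌉`. -/
def halfCeil (d : ℕ) : ℕ := ⌈(d : ℝ) / 2⌉₊

/-- The multi-indices `k ∈ ℕ^d` with `|k| ≤ J` (each entry is then at most `J`). -/
abbrev MultiIdx (d J : ℕ) : Type := {k : Fin d → Fin (J + 1) // ∑ i, (k i : ℕ) ≤ J}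

/-- The multi-index `0`. -/
def MultiIdx.zero (d J : ℕ) : MultiIdx d J := ⟨fun _ => 0, by simp⟩

/-- The partial derivative `∂_i g`. -/
def partialD {d : ℕ} (i : Fin d) (g : Eucl d → ℝ) : Eucl d → ℝ :=
  fun x => fderiv ℝ g x (EuclideanSpace.single i 1)

/-- The iterated partial derivative `D^k g = ∂_1^{k_1} ⋯ ∂_d^{k_d} g`. -/
def multiD {d : ℕ} (k : Fin d → ℕ) (g : Eucl d → ℝ) : Eucl d → ℝ :=
  (List.finRange d).foldr (fun i h => (partialD i)^[k i] h) g

/-- The measure `dx / (1 + |x|^{2b})` on `ℝ^d`. -/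
def weightedVolume (d b : ℕ) : Measure (Eucl d) :=
  volume.withDensity fun x => ENNReal.ofReal (1 + ‖x‖ ^ (2 * b))⁻¹

/-- Families `(u_k)_{|k| ≤ J}` in `L²(dx / (1 + |x|^{2b}))`, with the Hilbert norm
`(∑_{|k| ≤ J} ∫ |u_k|² / (1 + |x|^{2b}) dx)^{1/2}`. -/
abbrev JetSpace (d J b : ℕ) : Type :=
  PiLp 2 fun _ : MultiIdx d J => Lp ℝ 2 (weightedVolume d b)

/-- The families `(D^k g)_{|k| ≤ J}` of the functions `g ∈ C_c^∞(ℝ^d)`. -/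
def testJets (d J b : ℕ) : Set (JetSpace d J b) :=
  {u | ∃ g : Eucl d → ℝ, ContDiff ℝ (⊤ : ℕ∞) g ∧ HasCompactSupport g ∧
    ∀ k : MultiIdx d J, u k =ᵐ[weightedVolume d b] multiD (fun i => (k.1 i : ℕ)) g}

/-- The weighted Sobolev space `H^{J,b}(ℝ^d)` inside `JetSpace d J b`: the closure of `C_c^∞(ℝ^d)`
for the norm `(∑_{|k| ≤ J} ∫ |D^k g(x)|² / (1 + |x|^{2b}) dx)^{1/2}`, an element being stored as the
family of its (weak) derivatives of order at most `J`. The set `testJets` is itself a linear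
subspace, so that taking its span adds nothing. -/
def sobolevSubmodule (d J b : ℕ) : Submodule ℝ (JetSpace d J b) :=
  (Submodule.span ℝ (testJets d J b)).topologicalClosure

/-- The weighted Sobolev space `H^{J,b}(ℝ^d)`, a Hilbert space. -/
abbrev WSobolev (d J b : ℕ) : Type := sobolevSubmodule d J b

instance instNormedAddCommGroupWSobolev (d J b : ℕ) : NormedAddCommGroup (WSobolev d J b) :=
  inferInstance

instance instInnerProductSpaceWSobolev (d J b : ℕ) : InnerProductSpace ℝ (WSobolev d J b) :=
  inferInstance

instance instCompleteSpaceWSobolev (d J b : ℕ) : CompleteSpace (WSobolev d J b) :=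
  Submodule.topologicalClosure.completeSpace (Submodule.span ℝ (testJets d J b))

/-- The dual space `H^{-J,b}(ℝ^d)` of `H^{J,b}(ℝ^d)`, with the dual norm. -/
abbrev WSobolevDual (d J b : ℕ) : Type := StrongDual ℝ (WSobolev d J b)

/-- The Borel σ-algebra of `H^{-J,b}(ℝ^d)`. -/
instance instMeasurableSpaceWSobolevDual (d J b : ℕ) : MeasurableSpace (WSobolevDual d J b) :=
  borel _

/-- The equivalence class of functions that an element of `H^{J,b}(ℝ^d)` is. -/
def WSobolev.toFun {d J b : ℕ} (u : WSobolev d J b) : Eucl d → ℝ := u.1 (MultiIdx.zero d J)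

open Classical in
/-- The continuous representative of `u ∈ H^{J,b}(ℝ^d)`; it exists, and is of class `C^j`,
whenever `J > j + d/2`, and it is unique. -/
def WSobolev.rep {d J b : ℕ} (u : WSobolev d J b) : Eucl d → ℝ :=
  if h : ∃ f : Eucl d → ℝ, Continuous f ∧ u.toFun =ᵐ[volume] f then h.choose else u.toFun

open Classical in
/-- A function `g : ℝ^d → ℝ` as an element of `H^{J,b}(ℝ^d)` (the value is `0` when `g` is not
in that space). An element of `H^{J,b}(ℝ^d)` is determined by its function, since the other
components are the weak derivatives of it. -/
def toSobolev {d : ℕ} (J b : ℕ) (g : Eucl d → ℝ) : WSobolev d J b :=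
  if h : ∃ u : WSobolev d J b, u.toFun =ᵐ[volume] g then h.choose else 0

/-- The duality bracket `⟨g, Φ⟩ = Φ[g]` of a function `g ∈ H^{J,b}(ℝ^d)` and
`Φ ∈ H^{-J,b}(ℝ^d)`. -/
def bracket {d J b : ℕ} (g : Eucl d → ℝ) (Φ : WSobolevDual d J b) : ℝ := Φ (toSobolev J b g)

/-! ### Assumptions on the data -/

/-- `f ∈ C_b^∞(ℝ^d)`: smooth, with bounded derivatives of all orders (including order `0`). -/
def IsCbInfty {d : ℕ} (f : Eucl d → ℝ) : Prop :=
  ContDiff ℝ (⊤ : ℕ∞) f ∧ ∀ m : ℕ, ∃ C : ℝ, ∀ w, ‖iteratedFDeriv ℝ m f w‖ ≤ C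

/-- Smoothness of the activation function `σ(w, x)`: it is `C^∞` in the weight `w`, and its
derivatives in `w` of all orders (including order `0`) are continuous and bounded on
`ℝ^d × 𝒳`. Every `σ ∈ C_b^∞(ℝ^d × 𝒳)` has this property; no derivatives in `x`, which have no
canonical meaning on an arbitrary set `𝒳`, are needed. -/
structure IsSmoothActivation {d n : ℕ} {𝒳 : Set (Eucl n)} (σ : Eucl d → 𝒳 → ℝ) : Prop where
  contDiff : ∀ x, ContDiff ℝ (⊤ : ℕ∞) fun w => σ w x
  continuous : ∀ m : ℕ, Continuous fun p : Eucl d × 𝒳 =>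
    iteratedFDeriv ℝ m (fun w => σ w p.2) p.1
  bounded : ∀ m : ℕ, ∃ C : ℝ, ∀ (w : Eucl d) (x : 𝒳),
    ‖iteratedFDeriv ℝ m (fun w' => σ w' x) w‖ ≤ C

/-- The function `∇f · ∇σ(·, x)` on `ℝ^d`, the gradients being in the weight variable. -/
def gradDot {d n : ℕ} {𝒳 : Set (Eucl n)} (σ : Eucl d → 𝒳 → ℝ) (f : Eucl d → ℝ) (x : 𝒳) :
    Eucl d → ℝ :=
  fun w => inner ℝ (gradient f w) (gradient (fun w' => σ w' x) w)

/-! ### The mean-field limit -/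

/-- The Wasserstein distance `W_1(μ, ν) = inf E|X - Y|` over all couplings of `μ` and `ν`. -/
def wasserstein1 {d : ℕ} (μ ν : Measure (Eucl d)) : ℝ≥0∞ :=
  ⨅ (ρ : Measure (Eucl d × Eucl d)) (_ : ρ.map Prod.fst = μ ∧ ρ.map Prod.snd = ν),
    ∫⁻ p, edist p.1 p.2 ∂ρ

/-- `μ ∈ C(ℝ_+, P_1(ℝ^d))` is a solution, started at `μ₀`, of the measure-valued limit equation:
for all `f ∈ C_b^∞(ℝ^d)` and `t ≥ 0`,
`⟨f, μ_t⟩ = ⟨f, μ₀⟩ + ∫_0^t ∫ α (y - ⟨σ(·,x), μ_s⟩) ⟨∇f · ∇σ(·,x), μ_s⟩ π(dx,dy) ds`. -/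
structure IsMeanFieldLimit {d n : ℕ} {𝒳 : Set (Eucl n)} {𝒴 : Set ℝ} (σ : Eucl d → 𝒳 → ℝ)
    (α : ℝ) (π : Measure (𝒳 × 𝒴)) (μ₀ : ProbabilityMeasure (Eucl d))
    (μ : ℝ≥0 → ProbabilityMeasure (Eucl d)) : Prop where
  first_moment : ∀ t, ∫⁻ w, ‖w‖ₑ ∂(μ t : Measure (Eucl d)) < ∞
  continuous : ∀ t, Tendsto (fun s => wasserstein1 (μ s : Measure (Eucl d)) (μ t)) (𝓝 t) (𝓝 0)
  equation : ∀ f : Eucl d → ℝ, IsCbInfty f → ∀ t : ℝ≥0,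
    ∫ w, f w ∂(μ t : Measure (Eucl d)) = ∫ w, f w ∂(μ₀ : Measure (Eucl d)) +
      ∫ s in (0 : ℝ)..t, ∫ p : 𝒳 × 𝒴,
        α * ((p.2 : ℝ) - ∫ w, σ w p.1 ∂(μ s.toNNReal : Measure (Eucl d))) *
          ∫ w, gradDot σ f p.1 w ∂(μ s.toNNReal : Measure (Eucl d)) ∂π

/-! ### The G-process and the limit fluctuation equation -/

/-- `Q_v[f](x, y) = (y - ⟨σ(·,x), μ_v⟩) ⟨∇f · ∇σ(·,x), μ_v⟩`. -/
def Qfun {d n : ℕ} {𝒳 : Set (Eucl n)} {𝒴 : Set ℝ} (σ : Eucl d → 𝒳 → ℝ)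
    (μ : ℝ≥0 → ProbabilityMeasure (Eucl d)) (v : ℝ≥0) (f : Eucl d → ℝ) (p : 𝒳 × 𝒴) : ℝ :=
  ((p.2 : ℝ) - ∫ w, σ w p.1 ∂(μ v : Measure (Eucl d))) *
    ∫ w, gradDot σ f p.1 w ∂(μ v : Measure (Eucl d))

/-- `G` is a `C(ℝ_+, H^{-J,j}(ℝ^d))`-valued G-process: for all `f_1, …, f_k ∈ H^{J,j}(ℝ^d)` the
process `(⟨f_1, G_t⟩, …, ⟨f_k, G_t⟩)` is square integrable with zero mean, has independent
Gaussian increments, and has the covariance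
`Cov(⟨f_i, G_t⟩, ⟨f_j, G_s⟩) = α² κ ∫_0^s Cov(Q_v[f_i](x,y), Q_v[f_j](x,y)) dv` for `s ≤ t`, with
`(x, y) ∼ π`. The number `κ` stands for `E[1 / |B_∞|]`. -/
structure IsGProcess {d n : ℕ} {𝒳 : Set (Eucl n)} {𝒴 : Set ℝ} (σ : Eucl d → 𝒳 → ℝ)
    (α : ℝ) (π : Measure (𝒳 × 𝒴)) (μ : ℝ≥0 → ProbabilityMeasure (Eucl d)) (κ : ℝ) {J j : ℕ}
    {Ω : Type*} [MeasurableSpace Ω] (P : Measure Ω)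
    (G : Ω → C(ℝ≥0, WSobolevDual d J j)) : Prop where
  measurable : ∀ t, Measurable fun ω => G ω t
  memLp : ∀ (f : WSobolev d J j) (t : ℝ≥0), MemLp (fun ω => G ω t f) 2 P
  mean_zero : ∀ (f : WSobolev d J j) (t : ℝ≥0), ∫ ω, G ω t f ∂P = 0
  indep_increments : ∀ (k : ℕ) (f : Fin k → WSobolev d J j),
    HasIndepIncrements (fun (t : ℝ≥0) ω (i : Fin k) => G ω t (f i)) P
  gaussian_increments : ∀ (k : ℕ) (f : Fin k → WSobolev d J j) (s t : ℝ≥0), s ≤ t →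
    HasGaussianLaw (fun ω (i : Fin k) => G ω t (f i) - G ω s (f i)) P
  covariance : ∀ (f g : WSobolev d J j) (s t : ℝ≥0), s ≤ t →
    cov[fun ω => G ω t f, fun ω => G ω s g; P] =
      α ^ 2 * κ * ∫ v in (0 : ℝ)..s,
        cov[Qfun σ μ v.toNNReal f.rep, Qfun σ μ v.toNNReal g.rep; π]

/-- `η` is a `C(ℝ_+, H^{-J+1,j}(ℝ^d))`-valued process that solves the limit fluctuation equation
driven by `G`: almost surely, for all `f ∈ H^{J,j}(ℝ^d)` and all `t ≥ 0`,
`⟨f, η_t⟩ - ⟨f, η_0⟩ = ∫_0^t ∫ α (y - ⟨σ(·,x), μ_s⟩) ⟨∇f · ∇σ(·,x), η_s⟩ π(dx,dy) ds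
  - ∫_0^t ∫ α ⟨σ(·,x), η_s⟩ ⟨∇f · ∇σ(·,x), μ_s⟩ π(dx,dy) ds + ⟨f, G_t⟩`. -/
structure IsFluctuationSolution {d n : ℕ} {𝒳 : Set (Eucl n)} {𝒴 : Set ℝ} (σ : Eucl d → 𝒳 → ℝ)
    (α : ℝ) (π : Measure (𝒳 × 𝒴)) (μ : ℝ≥0 → ProbabilityMeasure (Eucl d)) {J j : ℕ}
    {Ω : Type*} [MeasurableSpace Ω] (P : Measure Ω)
    (G : Ω → C(ℝ≥0, WSobolevDual d J j)) (η : Ω → C(ℝ≥0, WSobolevDual d (J - 1) j)) : Prop where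
  measurable : ∀ t, Measurable fun ω => η ω t
  equation : ∀ᵐ ω ∂P, ∀ (f : WSobolev d J j) (t : ℝ≥0),
    bracket f.rep (η ω t) - bracket f.rep (η ω 0) =
      (∫ s in (0 : ℝ)..t, ∫ p : 𝒳 × 𝒴,
        α * ((p.2 : ℝ) - ∫ w, σ w p.1 ∂(μ s.toNNReal : Measure (Eucl d))) *
          bracket (gradDot σ f.rep p.1) (η ω s.toNNReal) ∂π) -
      (∫ s in (0 : ℝ)..t, ∫ p : 𝒳 × 𝒴,
        α * bracket (fun w => σ w p.1) (η ω s.toNNReal) *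
          ∫ w, gradDot σ f.rep p.1 w ∂(μ s.toNNReal : Measure (Eucl d)) ∂π) +
      G ω t f

end

/-! The difference `D` of two solutions with the same noise and the same initial value satisfies a
linear deterministic equation: `⟨f, D_t⟩` is the time integral of a transport term minus a nonlocal
term, and `D_0 = 0`. One has to show `D = 0`. The nonlocal term is harmless, since it tests `D` only
with the fixed smooth functions `σ(·, x)`. The transport term tests `D` with `∇f · ∇σ(·, x)` and so
costs one derivative of `f`; a direct Grönwall argument in a dual norm does not close.

The loss is avoided by reading the transport term along its flow. To first order in `c`, `f + c ∇f ·
∇σ(·, x)` is the composition of `f` with the near-identity map `w ↦ w + c ∇σ(w, x)`, and this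
composition increases a `C^n` norm by a factor `1 + O(|c|)` at most (`BddDeriv.shift`). The Taylor
remainder is `O(c²)` in `C^J` when `f` is bounded in `C^{J+2}` (`BddDeriv.shift_sub_sub`). Hence
`dualNorm`, the supremum of `|Φ(f)|` over the unit ball of `C^{J+2}`, grows under an Euler step of
length `r` by a factor `1 + O(r)` at most, up to an error `O(r²) ‖Φ‖` in the stronger norm of
`H^{-J,b}` (`IsSmoothActivation.exists_abs_add_mul_gradDot_le`, then
`exists_abs_add_mul_transportTerm_le` after averaging over the data, where the second moment of `y`
enters).

Along a solution, `s ↦ D_s` is continuous for the strong norm, so the errors are `o(r)` and the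
upper right derivative of `dualNorm (D_t)` is at most `C · dualNorm (D_t)`. Grönwall gives `dualNorm
(D_t) = 0`, and `D_t = 0` follows because `C_b^∞` is dense in `H^{J,b}`. The Sobolev part of the
file shows that `C_b^∞` functions do belong to `H^{J,b}`, with norms controlled by `C^J` bounds, so
that they may serve as test functions. -/

noncomputable section

/-! ### Calculus of `C^n` bounds -/

/-- The derivatives of `f` of order at most `n` are bounded by `K`. -/
def BddDeriv {E F : Type*} [NormedAddCommGroup E] [NormedSpace ℝ E] [NormedAddCommGroup F]
    [NormedSpace ℝ F] (n : ℕ) (K : ℝ) (f : E → F) : Prop :=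
  ∀ i ≤ n, ∀ w, ‖iteratedFDeriv ℝ i f w‖ ≤ K

namespace BddDeriv

section

variable {E F G H : Type*} [NormedAddCommGroup E] [NormedSpace ℝ E] [NormedAddCommGroup F]
  [NormedSpace ℝ F] [NormedAddCommGroup G] [NormedSpace ℝ G] [NormedAddCommGroup H]
  [NormedSpace ℝ H] {n m : ℕ} {K L : ℝ} {f g : E → F}

lemma mono (h : BddDeriv n K f) (hm : m ≤ n) (hK : K ≤ L) : BddDeriv m L f :=
  fun i hi w => (h i (hi.trans hm) w).trans hK

lemma norm_le (h : BddDeriv n K f) (w : E) : ‖f w‖ ≤ K := by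
  simpa using h 0 (Nat.zero_le _) w

lemma nonneg (h : BddDeriv n K f) : 0 ≤ K := (norm_nonneg _).trans (h.norm_le 0)

lemma zero_iff : BddDeriv 0 K f ↔ ∀ w, ‖f w‖ ≤ K := by
  refine ⟨fun h => h.norm_le, fun h i hi w => ?_⟩
  obtain rfl : i = 0 := by omega
  simpa using h w

/-- Peels off one derivative; the inductions on `n` for compositions below all run through it, with
`fderiv ℝ f` in the role of `f`. -/
lemma succ_iff : BddDeriv (n + 1) K f ↔ (∀ w, ‖f w‖ ≤ K) ∧ BddDeriv n K (fderiv ℝ f) := by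
  refine ⟨fun h => ⟨h.norm_le, fun i hi w => ?_⟩, fun h i hi w => ?_⟩
  · rw [norm_iteratedFDeriv_fderiv]
    exact h _ (by omega) w
  · rcases i with _ | i
    · simpa using h.1 w
    · rw [← norm_iteratedFDeriv_fderiv]
      exact h.2 i (by omega) w

lemma fderiv (h : BddDeriv (n + 1) K f) : BddDeriv n K (fderiv ℝ f) := (succ_iff.1 h).2

lemma add (hf : BddDeriv n K f) (hg : BddDeriv n L g) (hf' : ContDiff ℝ (⊤ : ℕ∞) f)
    (hg' : ContDiff ℝ (⊤ : ℕ∞) g) : BddDeriv n (K + L) (fun w => f w + g w) := by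
  intro i hi w
  have : (fun w => f w + g w) = f + g := rfl
  rw [this, iteratedFDeriv_add_apply (hf'.contDiffAt.of_le (by exact_mod_cast le_top))
    (hg'.contDiffAt.of_le (by exact_mod_cast le_top))]
  exact (norm_add_le _ _).trans (add_le_add (hf i hi w) (hg i hi w))

lemma contDiff_const_smul (hf : ContDiff ℝ (⊤ : ℕ∞) f) (c : ℝ) :
    ContDiff ℝ (⊤ : ℕ∞) (fun w => c • f w) := contDiff_const.smul hf

lemma const_smul (hf : BddDeriv n K f) (hf' : ContDiff ℝ (⊤ : ℕ∞) f) (c : ℝ) :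
    BddDeriv n (|c| * K) (fun w => c • f w) := by
  intro i hi w
  rw [iteratedFDeriv_const_smul_apply' (hf'.contDiffAt.of_le (by exact_mod_cast le_top)),
    norm_smul, Real.norm_eq_abs]
  exact mul_le_mul_of_nonneg_left (hf i hi w) (abs_nonneg c)

lemma sub (hf : BddDeriv n K f) (hg : BddDeriv n L g) (hf' : ContDiff ℝ (⊤ : ℕ∞) f)
    (hg' : ContDiff ℝ (⊤ : ℕ∞) g) : BddDeriv n (K + L) (fun w => f w - g w) := by
  have := hf.add (hg.const_smul hg' (-1)) hf' (contDiff_const_smul hg' _)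
  simpa [sub_eq_add_neg] using this

/-- Leibniz rule; `2 ^ n` bounds the sum of the binomial coefficients. -/
lemma bilinear (B : F →L[ℝ] G →L[ℝ] H) (hB : ‖B‖ ≤ 1) {g : E → G} (hf : BddDeriv n K f)
    (hg : BddDeriv n L g) (hf' : ContDiff ℝ (⊤ : ℕ∞) f) (hg' : ContDiff ℝ (⊤ : ℕ∞) g) :
    BddDeriv n (2 ^ n * (K * L)) (fun w => B (f w) (g w)) := by
  intro i hi w
  have hK := hf.nonneg
  have hL := hg.nonneg
  refine (B.norm_iteratedFDeriv_le_of_bilinear_of_le_one hf' hg' w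
    (n := i) (by exact_mod_cast le_top) hB).trans ?_
  calc _ ≤ ∑ j ∈ Finset.range (i + 1), (i.choose j : ℝ) * (K * L) := by
        refine Finset.sum_le_sum fun j hj => ?_
        rw [mul_assoc]
        have hj' : j ≤ i := by simpa [Nat.lt_succ_iff] using hj
        exact mul_le_mul_of_nonneg_left (mul_le_mul (hf j (hj'.trans hi) w)
          (hg (i - j) (by omega) w) (norm_nonneg _) hK) (by positivity)
    _ = 2 ^ i * (K * L) := by
        rw [← Finset.sum_mul]
        congr 1
        exact_mod_cast Nat.sum_range_choose i
    _ ≤ _ := by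
        gcongr
        norm_num

lemma clm_apply {f : E → F →L[ℝ] G} {g : E → F} (hf : BddDeriv n K f)
    (hg : BddDeriv n L g) (hf' : ContDiff ℝ (⊤ : ℕ∞) f) (hg' : ContDiff ℝ (⊤ : ℕ∞) g) :
    BddDeriv n (2 ^ n * (K * L)) (fun w => f w (g w)) :=
  hf.bilinear (ContinuousLinearMap.id ℝ (F →L[ℝ] G)) ContinuousLinearMap.norm_id_le hg hf' hg'

lemma clm_comp {f : E → F →L[ℝ] G} {g : E → E →L[ℝ] F} (hf : BddDeriv n K f)
    (hg : BddDeriv n L g) (hf' : ContDiff ℝ (⊤ : ℕ∞) f) (hg' : ContDiff ℝ (⊤ : ℕ∞) g) :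
    BddDeriv n (2 ^ n * (K * L)) (fun w => (f w).comp (g w)) :=
  hf.bilinear (ContinuousLinearMap.compL ℝ E F G) (ContinuousLinearMap.norm_compL_le ℝ E F G)
    hg hf' hg'

lemma norm_sub_le (h : BddDeriv 1 K f) (hf : ContDiff ℝ (⊤ : ℕ∞) f) (x y : E) :
    ‖f y - f x‖ ≤ K * ‖y - x‖ := by
  refine Convex.norm_image_sub_le_of_norm_fderiv_le (𝕜 := ℝ) (s := Set.univ)
    (fun z _ => (hf.differentiable (by simp)) z) (fun z _ => ?_) convex_univ trivial trivial
  exact (h.fderiv).norm_le z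

/-- Mean value inequality on the ball of radius `‖v‖` about `x`, where the derivative differs from
its value at `x` by at most `K * ‖v‖`. This gives `K` instead of the sharp `K / 2`. -/
lemma norm_sub_sub_le (h : BddDeriv 2 K f) (hf : ContDiff ℝ (⊤ : ℕ∞) f) (x v : E) :
    ‖f (x + v) - f x - _root_.fderiv ℝ f x v‖ ≤ K * ‖v‖ ^ 2 := by
  have hf1 : ContDiff ℝ (⊤ : ℕ∞) (_root_.fderiv ℝ f) := hf.fderiv_right (by simp)
  have key := Convex.norm_image_sub_le_of_norm_fderiv_le' (𝕜 := ℝ) (f := f)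
    (s := Metric.closedBall x ‖v‖) (C := K * ‖v‖) (φ := _root_.fderiv ℝ f x) (x := x) (y := x + v)
    (fun z _ => (hf.differentiable (by simp)) z) (fun z hz => ?_) (convex_closedBall _ _)
    (by simp) (by simp)
  · simpa [pow_two, mul_assoc] using key
  · refine (h.fderiv.norm_sub_le hf1 x z).trans ?_
    exact mul_le_mul_of_nonneg_left (by simpa [dist_eq_norm] using hz) h.nonneg

end

/-! ### Composition with near-identity maps `w ↦ w + c u(w)` -/

section

variable {E : Type} [NormedAddCommGroup E] [NormedSpace ℝ E]

lemma contDiff_shift {F : Type*} [NormedAddCommGroup F] [NormedSpace ℝ F] {f : E → F} {u : E → E}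
    (hf : ContDiff ℝ (⊤ : ℕ∞) f) (hu : ContDiff ℝ (⊤ : ℕ∞) u) (c : ℝ) :
    ContDiff ℝ (⊤ : ℕ∞) (fun w => f (w + c • u w)) :=
  hf.comp (contDiff_id.add (contDiff_const.smul hu))

lemma hasFDerivAt_shift {F : Type*} [NormedAddCommGroup F] [NormedSpace ℝ F] {f : E → F}
    {u : E → E} (hf : ContDiff ℝ (⊤ : ℕ∞) f) (hu : ContDiff ℝ (⊤ : ℕ∞) u) (c : ℝ) (w : E) :
    HasFDerivAt (fun w => f (w + c • u w))
      (_root_.fderiv ℝ f (w + c • u w) +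
        c • (_root_.fderiv ℝ f (w + c • u w)).comp (_root_.fderiv ℝ u w)) w := by
  have h1 : HasFDerivAt f (_root_.fderiv ℝ f (w + c • u w)) (w + c • u w) :=
    ((hf.differentiable (by simp)) _).hasFDerivAt
  have h2 : HasFDerivAt (fun w => w + c • u w)
      (ContinuousLinearMap.id ℝ E + c • _root_.fderiv ℝ u w) w :=
    (hasFDerivAt_id w).add (((hu.differentiable (by simp)) w).hasFDerivAt.const_smul c)
  have h3 := h1.comp w h2
  rw [ContinuousLinearMap.comp_add, ContinuousLinearMap.comp_id,
    ContinuousLinearMap.comp_smul] at h3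
  exact h3

/-- Composition with `w ↦ w + c u(w)` increases the `C^n` norm by a factor `1 + O(c)` at most. -/
lemma shift (M : ℝ) (n : ℕ) : ∃ C : ℝ, 0 ≤ C ∧ ∀ {F : Type} [NormedAddCommGroup F]
    [NormedSpace ℝ F] {f : E → F} {u : E → E} {c K : ℝ}, ContDiff ℝ (⊤ : ℕ∞) f →
    ContDiff ℝ (⊤ : ℕ∞) u → BddDeriv (n + 1) M u → |c| ≤ 1 → BddDeriv n K f →
    BddDeriv n ((1 + C * |c|) * K) (fun w => f (w + c • u w)) := by
  -- The target space is quantified inside the claim because the induction hypothesis is applied to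
  -- `fderiv ℝ f`, with values in `E →L[ℝ] F`. Keeping `E` and `F` in `Type` keeps that space in the
  -- same universe.
  induction n with
  | zero =>
    refine ⟨0, le_rfl, fun {F} _ _ {f u c K} hf hu hM hc h => zero_iff.2 fun w => ?_⟩
    simpa using h.norm_le _
  | succ n ih =>
    obtain ⟨C, hC, ih⟩ := ih
    -- By the chain rule the derivative is `Df` shifted, with factor `1 + C|c|` by induction, plus
    -- `c` times a bounded product. Only the coefficient of `|c|` grows; the leading `1` survives.
    refine ⟨C + 2 ^ n * ((1 + C) * |M|), by positivity,
      fun {F} _ _ {f u c K} hf hu hM hc h => succ_iff.2 ⟨fun w => ?_, ?_⟩⟩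
    · refine (h.norm_le _).trans (le_mul_of_one_le_left h.nonneg ?_)
      have : 0 ≤ (C + 2 ^ n * ((1 + C) * |M|)) * |c| := by positivity
      linarith
    · have hf1 : ContDiff ℝ (⊤ : ℕ∞) (_root_.fderiv ℝ f) := hf.fderiv_right (by simp)
      have hu1 : ContDiff ℝ (⊤ : ℕ∞) (_root_.fderiv ℝ u) := hu.fderiv_right (by simp)
      have hs := contDiff_shift hf1 hu c
      have hK := h.nonneg
      have e : _root_.fderiv ℝ (fun w => f (w + c • u w)) = fun w =>
          _root_.fderiv ℝ f (w + c • u w) +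
            c • (_root_.fderiv ℝ f (w + c • u w)).comp (_root_.fderiv ℝ u w) :=
        funext fun w => (hasFDerivAt_shift hf hu c w).fderiv
      rw [e]
      have h1 := ih hf1 hu (hM.mono (by omega) le_rfl) hc h.fderiv
      have h2 := h1.clm_comp (hM.fderiv.mono (by omega) (le_abs_self M)) hs hu1
      refine (h1.add (h2.const_smul (hs.clm_comp hu1) c) hs
        (contDiff_const_smul (hs.clm_comp hu1) c)).mono le_rfl ?_
      have : (1 + C * |c|) * K * |M| ≤ (1 + C) * K * |M| := by
        have : C * |c| ≤ C := mul_le_of_le_one_right hC hc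
        gcongr
      calc (1 + C * |c|) * K + |c| * (2 ^ n * ((1 + C * |c|) * K * |M|))
          ≤ (1 + C * |c|) * K + |c| * (2 ^ n * ((1 + C) * K * |M|)) := by gcongr
        _ = _ := by ring

/-- First-order companion of `shift`, at the cost of one derivative of `f`. It controls the
commutator term in `shift_sub_sub`. -/
lemma shift_sub (M : ℝ) (n : ℕ) : ∃ C : ℝ, 0 ≤ C ∧ ∀ {F : Type} [NormedAddCommGroup F]
    [NormedSpace ℝ F] {f : E → F} {u : E → E} {c K : ℝ}, ContDiff ℝ (⊤ : ℕ∞) f →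
    ContDiff ℝ (⊤ : ℕ∞) u → BddDeriv (n + 1) M u → |c| ≤ 1 → BddDeriv (n + 1) K f →
    BddDeriv n (C * |c| * K) (fun w => f (w + c • u w) - f w) := by
  have base : ∀ {n : ℕ} {F : Type} [NormedAddCommGroup F] [NormedSpace ℝ F] {f : E → F}
      {u : E → E} {c K : ℝ}, ContDiff ℝ (⊤ : ℕ∞) f → BddDeriv n M u → BddDeriv (n + 1) K f →
      ∀ w, ‖f (w + c • u w) - f w‖ ≤ |M| * |c| * K := by
    intro n F _ _ f u c K hf hM h w
    refine ((h.mono (by omega) le_rfl).norm_sub_le hf w _).trans ?_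
    rw [add_sub_cancel_left, norm_smul, Real.norm_eq_abs]
    have hK := h.nonneg
    calc K * (|c| * ‖u w‖) ≤ K * (|c| * |M|) := by
          gcongr
          exact (hM.norm_le w).trans (le_abs_self M)
      _ = _ := by ring
  induction n with
  | zero =>
    exact ⟨|M|, abs_nonneg M, fun {F} _ _ {f u c K} hf hu hM hc h =>
      zero_iff.2 (base hf (hM.mono (Nat.zero_le _) le_rfl) h)⟩
  | succ n ih =>
    obtain ⟨C, hC, ih⟩ := ih
    obtain ⟨C', hC', ih'⟩ := shift (E := E) M n
    refine ⟨|M| + (C + 2 ^ n * ((1 + C') * |M|)), by positivity,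
      fun {F} _ _ {f u c K} hf hu hM hc h => succ_iff.2 ⟨fun w => ?_, ?_⟩⟩
    · have hK := h.nonneg
      refine (base (n := 0) hf (hM.mono (Nat.zero_le _) le_rfl)
        (h.mono (by omega) le_rfl) w).trans ?_
      gcongr
      exact le_add_of_nonneg_right (by positivity)
    · have hf1 : ContDiff ℝ (⊤ : ℕ∞) (_root_.fderiv ℝ f) := hf.fderiv_right (by simp)
      have hu1 : ContDiff ℝ (⊤ : ℕ∞) (_root_.fderiv ℝ u) := hu.fderiv_right (by simp)
      have hs := contDiff_shift hf1 hu c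
      have hK := h.nonneg
      have e : _root_.fderiv ℝ (fun w => f (w + c • u w) - f w) = fun w =>
          (_root_.fderiv ℝ f (w + c • u w) - _root_.fderiv ℝ f w) +
            c • (_root_.fderiv ℝ f (w + c • u w)).comp (_root_.fderiv ℝ u w) := by
        funext w
        refine HasFDerivAt.fderiv ?_
        rw [sub_add_eq_add_sub]
        exact (hasFDerivAt_shift hf hu c w).sub ((hf.differentiable (by simp)) w).hasFDerivAt
      rw [e]
      have h1 := ih hf1 hu (hM.mono (by omega) le_rfl) hc h.fderiv
      have h2 := (ih' hf1 hu (hM.mono (by omega) le_rfl) hc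
        (h.fderiv.mono (by omega) le_rfl)).clm_comp
        (hM.fderiv.mono (by omega) (le_abs_self M)) hs hu1
      refine (h1.add (h2.const_smul (hs.clm_comp hu1) c) (hs.sub hf1)
        (contDiff_const_smul (hs.clm_comp hu1) c)).mono le_rfl ?_
      have : (1 + C' * |c|) * K * |M| ≤ (1 + C') * K * |M| := by
        have : C' * |c| ≤ C' := mul_le_of_le_one_right hC' hc
        gcongr
      calc C * |c| * K + |c| * (2 ^ n * ((1 + C' * |c|) * K * |M|))
          ≤ C * |c| * K + |c| * (2 ^ n * ((1 + C') * K * |M|)) := by gcongr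
        _ = (C + 2 ^ n * ((1 + C') * |M|)) * |c| * K := by ring
        _ ≤ _ := mul_le_mul_of_nonneg_right (mul_le_mul_of_nonneg_right
          (le_add_of_nonneg_left (abs_nonneg M)) (abs_nonneg c)) hK

/-- Differentiating the Taylor remainder of `f` gives the remainder of `Df` plus `c (Df(w + c u) -
Df(w)) ∘ Du`. The first is handled by induction; the second is `c` times an `O(c)` term by
`shift_sub`. -/
lemma shift_sub_sub (M : ℝ) (n : ℕ) : ∃ C : ℝ, 0 ≤ C ∧ ∀ {F : Type} [NormedAddCommGroup F]
    [NormedSpace ℝ F] {f : E → F} {u : E → E} {c K : ℝ}, ContDiff ℝ (⊤ : ℕ∞) f →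
    ContDiff ℝ (⊤ : ℕ∞) u → BddDeriv (n + 1) M u → |c| ≤ 1 → BddDeriv (n + 2) K f →
    BddDeriv n (C * c ^ 2 * K)
      (fun w => f (w + c • u w) - f w - c • _root_.fderiv ℝ f w (u w)) := by
  have base : ∀ {n : ℕ} {F : Type} [NormedAddCommGroup F] [NormedSpace ℝ F] {f : E → F}
      {u : E → E} {c K : ℝ}, ContDiff ℝ (⊤ : ℕ∞) f → BddDeriv n M u → BddDeriv (n + 2) K f →
      ∀ w, ‖f (w + c • u w) - f w - c • _root_.fderiv ℝ f w (u w)‖ ≤ M ^ 2 * c ^ 2 * K := by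
    intro n F _ _ f u c K hf hM h w
    have h1 := (h.mono (m := 2) (by omega) le_rfl).norm_sub_sub_le hf w (c • u w)
    rw [map_smul, norm_smul, Real.norm_eq_abs, mul_pow, sq_abs] at h1
    refine h1.trans ?_
    have hK := h.nonneg
    calc K * (c ^ 2 * ‖u w‖ ^ 2) ≤ K * (c ^ 2 * M ^ 2) := by
          gcongr
          exact hM.norm_le w
      _ = _ := by ring
  induction n with
  | zero =>
    exact ⟨M ^ 2, sq_nonneg M, fun {F} _ _ {f u c K} hf hu hM hc h =>
      zero_iff.2 (base hf (hM.mono (Nat.zero_le _) le_rfl) h)⟩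
  | succ n ih =>
    obtain ⟨C, hC, ih⟩ := ih
    obtain ⟨C', hC', ih'⟩ := shift_sub (E := E) M n
    refine ⟨M ^ 2 + (C + 2 ^ n * (C' * |M|)), by positivity,
      fun {F} _ _ {f u c K} hf hu hM hc h => succ_iff.2 ⟨fun w => ?_, ?_⟩⟩
    · have hK := h.nonneg
      refine (base (n := 0) hf (hM.mono (Nat.zero_le _) le_rfl)
        (h.mono (by omega) le_rfl) w).trans ?_
      gcongr
      exact le_add_of_nonneg_right (by positivity)
    · have hf1 : ContDiff ℝ (⊤ : ℕ∞) (_root_.fderiv ℝ f) := hf.fderiv_right (by simp)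
      have hf2 : ContDiff ℝ (⊤ : ℕ∞) (_root_.fderiv ℝ (_root_.fderiv ℝ f)) :=
        hf1.fderiv_right (by simp)
      have hu1 : ContDiff ℝ (⊤ : ℕ∞) (_root_.fderiv ℝ u) := hu.fderiv_right (by simp)
      have hs := contDiff_shift hf1 hu c
      have hK := h.nonneg
      have e : _root_.fderiv ℝ (fun w => f (w + c • u w) - f w - c • _root_.fderiv ℝ f w (u w)) =
          fun w => (_root_.fderiv ℝ f (w + c • u w) - _root_.fderiv ℝ f w -
            c • _root_.fderiv ℝ (_root_.fderiv ℝ f) w (u w)) +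
            c • (_root_.fderiv ℝ f (w + c • u w) - _root_.fderiv ℝ f w).comp
              (_root_.fderiv ℝ u w) := by
        funext w
        -- Differentiating `Df(w)(u w)` in direction `v` produces `D²f(v, u)`, whereas the remainder
        -- of `Df` contains `D²f(u, v)`.
        have hsymm := (hf.contDiffAt (x := w)).isSymmSndFDerivAt
          (by
            rw [minSmoothness_of_isRCLikeNormedField]
            exact (WithTop.coe_le_coe.2 le_top : ((2 : ℕ∞) : WithTop ℕ∞) ≤ (⊤ : ℕ∞)))
        have hd : HasFDerivAt
            (fun w => f (w + c • u w) - f w - c • _root_.fderiv ℝ f w (u w)) _ w :=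
          ((hasFDerivAt_shift hf hu c w).sub ((hf.differentiable (by simp)) w).hasFDerivAt).sub
            ((((hf1.differentiable (by simp)) w).hasFDerivAt.clm_apply
              ((hu.differentiable (by simp)) w).hasFDerivAt).const_smul c)
        rw [hd.fderiv]
        ext v
        have := hsymm.eq v (u w)
        simp [this, smul_sub]
        abel
      rw [e]
      have h1 := ih hf1 hu (hM.mono (by omega) le_rfl) hc h.fderiv
      have h2 := (ih' hf1 hu (hM.mono (by omega) le_rfl) hc
        (h.fderiv.mono (by omega) le_rfl)).clm_comp
        (hM.fderiv.mono (by omega) (le_abs_self M)) (hs.sub hf1) hu1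
      refine (h1.add (h2.const_smul ((hs.sub hf1).clm_comp hu1) c)
        ((hs.sub hf1).sub (contDiff_const_smul (hf2.clm_apply hu) c))
        (contDiff_const_smul ((hs.sub hf1).clm_comp hu1) c)).mono le_rfl ?_
      calc C * c ^ 2 * K + |c| * (2 ^ n * (C' * |c| * K * |M|))
          = (C + 2 ^ n * (C' * |M|)) * c ^ 2 * K := by
            rw [← sq_abs c]; ring
        _ ≤ _ := mul_le_mul_of_nonneg_right (mul_le_mul_of_nonneg_right
          (le_add_of_nonneg_left (sq_nonneg M)) (sq_nonneg c)) hK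

end

end BddDeriv

section

variable {d J b : ℕ}

/-! ### The weighted measure -/

lemma weight_pos (b : ℕ) (x : Eucl d) : 0 < (1 + ‖x‖ ^ (2 * b)) := by positivity

lemma contDiff_weight (b : ℕ) : ContDiff ℝ (⊤ : ℕ∞) fun x : Eucl d => 1 + ‖x‖ ^ (2 * b) := by
  simp_rw [pow_mul]
  exact contDiff_const.add ((contDiff_norm_sq ℝ).pow b)

lemma contDiff_weight_inv (b : ℕ) :
    ContDiff ℝ (⊤ : ℕ∞) fun x : Eucl d => (1 + ‖x‖ ^ (2 * b))⁻¹ :=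
  (contDiff_weight b).inv fun x => (weight_pos b x).ne'

lemma measurable_weight (b : ℕ) :
    Measurable fun x : Eucl d => ENNReal.ofReal (1 + ‖x‖ ^ (2 * b))⁻¹ :=
  (contDiff_weight_inv b).continuous.measurable.ennreal_ofReal

/-- Finiteness of the weighted measure is what puts bounded functions in the weighted `L²`, and
hence `C_b^∞` in `H^{J,b}`. -/
lemma isFiniteMeasure_weightedVolume (h : d < 2 * b) : IsFiniteMeasure (weightedVolume d b) := by
  refine isFiniteMeasure_withDensity_ofReal (Integrable.hasFiniteIntegral ?_)
  have h1 : Integrable (fun x : Eucl d => (1 + ‖x‖) ^ (-((2 * b : ℕ) : ℝ))) volume :=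
    integrable_one_add_norm (by simpa using (by exact_mod_cast h : (d : ℝ) < (2 * b : ℕ)))
  refine (h1.const_mul ((2 : ℝ) ^ (2 * b))).mono'
    (contDiff_weight_inv b).continuous.aestronglyMeasurable (ae_of_all _ fun x => ?_)
  rw [Real.norm_of_nonneg (by positivity), Real.rpow_neg (by positivity), Real.rpow_natCast,
    ← div_eq_mul_inv, inv_eq_one_div, div_le_div_iff₀ (by positivity) (by positivity), one_mul]
  calc (1 + ‖x‖) ^ (2 * b) ≤ 2 ^ (2 * b - 1) * (1 ^ (2 * b) + ‖x‖ ^ (2 * b)) :=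
        add_pow_le (by norm_num) (norm_nonneg x) _
    _ ≤ 2 ^ (2 * b) * (1 + ‖x‖ ^ (2 * b)) := by
        rw [one_pow]
        gcongr
        · norm_num
        · omega

lemma absolutelyContinuous_weightedVolume : (volume : Measure (Eucl d)) ≪ weightedVolume d b :=
  withDensity_absolutelyContinuous' (measurable_weight b).aemeasurable
    (ae_of_all _ fun x => by simpa using weight_pos b x)

lemma integral_weightedVolume (f : Eucl d → ℝ) :
    ∫ x, f x ∂weightedVolume d b = ∫ x, (1 + ‖x‖ ^ (2 * b))⁻¹ * f x := by
  rw [weightedVolume, integral_withDensity_eq_integral_toReal_smul (measurable_weight b)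
    (ae_of_all _ fun x => ENNReal.ofReal_lt_top)]
  refine integral_congr_ae (ae_of_all _ fun x => ?_)
  simp only [smul_eq_mul]
  rw [ENNReal.toReal_ofReal (by positivity)]

/-! ### Iterated partial derivatives -/

/-- `T g` is the function `x ↦ D^n g(x)[v_1, …, v_n]`, for some vectors `v_i` in the unit ball. -/
def IsIteratedDir (n : ℕ) (T : (Eucl d → ℝ) → Eucl d → ℝ) : Prop :=
  ∃ v : Fin n → Eucl d, (∀ i, ‖v i‖ ≤ 1) ∧ ∀ g, ContDiff ℝ (⊤ : ℕ∞) g →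
    T g = fun x => iteratedFDeriv ℝ n g x v

lemma IsIteratedDir.zero : IsIteratedDir (d := d) 0 id :=
  ⟨Fin.elim0, fun i => i.elim0, fun g _ => by ext x; simp⟩

lemma IsIteratedDir.partialD {n : ℕ} {T : (Eucl d → ℝ) → Eucl d → ℝ} (h : IsIteratedDir n T)
    (i : Fin d) : IsIteratedDir (n + 1) (partialD i ∘ T) := by
  obtain ⟨v, hv, hT⟩ := h
  refine ⟨Fin.cons (EuclideanSpace.single i 1) v, fun j => ?_, fun g hg => ?_⟩
  · refine Fin.cases ?_ (fun j => ?_) j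
    · simp
    · simpa using hv j
  · ext x
    have hd : DifferentiableAt ℝ (iteratedFDeriv ℝ n g) x :=
      hg.differentiable_iteratedFDeriv (m := n) (by exact_mod_cast WithTop.coe_lt_top _) x
    rw [iteratedFDeriv_succ_apply_left, Function.comp_apply, hT g hg, _root_.partialD]
    have h2 := (ContinuousMultilinearMap.apply ℝ (fun _ : Fin n => Eucl d) ℝ v).hasFDerivAt.comp x
      hd.hasFDerivAt
    have h3 : fderiv ℝ (fun x => iteratedFDeriv ℝ n g x v) x = _ := h2.fderiv
    rw [h3]
    simp

lemma IsIteratedDir.iterate_partialD {n : ℕ} {T : (Eucl d → ℝ) → Eucl d → ℝ}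
    (h : IsIteratedDir n T) (i : Fin d) (m : ℕ) :
    IsIteratedDir (m + n) ((_root_.partialD i)^[m] ∘ T) := by
  induction m with
  | zero => simpa using h
  | succ m ih =>
    have := ih.partialD i
    rw [← Function.comp_assoc, ← Function.iterate_succ'] at this
    rwa [show m + 1 + n = m + n + 1 by omega]

lemma isIteratedDir_multiD (k : Fin d → ℕ) : IsIteratedDir (∑ i, k i) (multiD k) := by
  rw [Fin.sum_univ_def]
  unfold multiD
  induction List.finRange d with
  | nil => exact IsIteratedDir.zero
  | cons i l ih =>
    rw [List.map_cons, List.sum_cons]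
    exact ih.iterate_partialD i (k i)

/-- `T` maps smooth functions to smooth functions, and has a formal adjoint on `C_c^∞`. -/
def HasFormalAdjoint (T : (Eucl d → ℝ) → Eucl d → ℝ) : Prop :=
  (∀ g, ContDiff ℝ (⊤ : ℕ∞) g → ContDiff ℝ (⊤ : ℕ∞) (T g)) ∧
    ∀ φ : Eucl d → ℝ, ContDiff ℝ (⊤ : ℕ∞) φ → HasCompactSupport φ →
      ∃ ψ : Eucl d → ℝ, ContDiff ℝ (⊤ : ℕ∞) ψ ∧ HasCompactSupport ψ ∧
        ∀ g, ContDiff ℝ (⊤ : ℕ∞) g → ∫ x, T g x * φ x = ∫ x, g x * ψ x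

lemma HasFormalAdjoint.id : HasFormalAdjoint (d := d) id :=
  ⟨fun _ hg => hg, fun φ h h' => ⟨φ, h, h', fun _ _ => rfl⟩⟩

lemma HasFormalAdjoint.comp {S T : (Eucl d → ℝ) → Eucl d → ℝ} (hS : HasFormalAdjoint S)
    (hT : HasFormalAdjoint T) : HasFormalAdjoint (S ∘ T) := by
  refine ⟨fun g hg => hS.1 _ (hT.1 g hg), fun φ h h' => ?_⟩
  obtain ⟨ψ, h1, h1', h2⟩ := hS.2 φ h h'
  obtain ⟨χ, h3, h3', h4⟩ := hT.2 ψ h1 h1'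
  exact ⟨χ, h3, h3', fun g hg => (h2 _ (hT.1 g hg)).trans (h4 g hg)⟩

lemma HasFormalAdjoint.partialD (i : Fin d) : HasFormalAdjoint (partialD i) := by
  have hs : ∀ g : Eucl d → ℝ, ContDiff ℝ (⊤ : ℕ∞) g →
      ContDiff ℝ (⊤ : ℕ∞) (_root_.partialD i g) := fun g hg =>
    (hg.fderiv_right (m := (⊤ : ℕ∞)) (by simp)).clm_apply contDiff_const
  refine ⟨hs, fun φ h h' => ⟨fun x => -_root_.partialD i φ x, (hs φ h).neg,
    (h'.fderiv_apply ℝ _).neg, fun g hg => ?_⟩⟩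
  have hc : HasCompactSupport (_root_.partialD i φ) := h'.fderiv_apply ℝ _
  have := integral_mul_fderiv_eq_neg_fderiv_mul_of_integrable (μ := volume) (f := g) (g := φ)
    (v := EuclideanSpace.single i (1 : ℝ))
    (Continuous.integrable_of_hasCompactSupport ((hs g hg).continuous.mul h.continuous)
      h'.mul_left)
    (Continuous.integrable_of_hasCompactSupport (hg.continuous.mul (hs φ h).continuous)
      hc.mul_left)
    (Continuous.integrable_of_hasCompactSupport (hg.continuous.mul h.continuous) h'.mul_left)
    (fun x _ => (hg.differentiable (by simp)) x) (fun x _ => (h.differentiable (by simp)) x)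
  simp only [mul_neg, integral_neg]
  exact (neg_eq_iff_eq_neg.2 this).symm

lemma HasFormalAdjoint.iterate {T : (Eucl d → ℝ) → Eucl d → ℝ} (h : HasFormalAdjoint T)
    (m : ℕ) : HasFormalAdjoint T^[m] := by
  induction m with
  | zero => exact HasFormalAdjoint.id
  | succ m ih => exact ih.comp h

lemma hasFormalAdjoint_multiD (k : Fin d → ℕ) : HasFormalAdjoint (multiD k) := by
  unfold multiD
  induction List.finRange d with
  | nil => exact HasFormalAdjoint.id
  | cons i l ih => exact ((HasFormalAdjoint.partialD i).iterate (k i)).comp ih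

lemma multiD_zero (g : Eucl d → ℝ) : multiD (fun _ => 0) g = g := by
  unfold multiD
  induction List.finRange d with
  | nil => rfl
  | cons i l ih => simp

lemma multiD_sub (k : Fin d → ℕ) {f g : Eucl d → ℝ} (hf : ContDiff ℝ (⊤ : ℕ∞) f)
    (hg : ContDiff ℝ (⊤ : ℕ∞) g) :
    multiD k (fun x => f x - g x) = fun x => multiD k f x - multiD k g x := by
  obtain ⟨v, -, h⟩ := isIteratedDir_multiD k
  rw [h f hf, h g hg, h _ (hf.sub hg)]
  ext x
  have : (fun x => f x - g x) = f - g := rfl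
  rw [this, iteratedFDeriv_sub_apply (hf.contDiffAt.of_le (by exact_mod_cast le_top))
    (hg.contDiffAt.of_le (by exact_mod_cast le_top))]
  rfl

lemma multiD_const_smul (k : Fin d → ℕ) (c : ℝ) {f : Eucl d → ℝ}
    (hf : ContDiff ℝ (⊤ : ℕ∞) f) :
    multiD k (fun x => c • f x) = fun x => c • multiD k f x := by
  obtain ⟨v, -, h⟩ := isIteratedDir_multiD k
  rw [h f hf, h _ (BddDeriv.contDiff_const_smul hf c)]
  ext x
  rw [iteratedFDeriv_const_smul_apply' (hf.contDiffAt.of_le (by exact_mod_cast le_top))]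
  rfl

lemma norm_multiD_le (k : Fin d → ℕ) {g : Eucl d → ℝ} (hg : ContDiff ℝ (⊤ : ℕ∞) g) (x : Eucl d) :
    ‖multiD k g x‖ ≤ ‖iteratedFDeriv ℝ (∑ i, k i) g x‖ := by
  obtain ⟨v, hv, h⟩ := isIteratedDir_multiD k
  rw [h g hg]
  refine (ContinuousMultilinearMap.le_opNorm _ v).trans (mul_le_of_le_one_right (norm_nonneg _) ?_)
  exact Finset.prod_le_one (fun i _ => norm_nonneg _) fun i _ => hv i

/-! ### Jets of smooth functions -/

/-- `u` is the family of the derivatives of `g`. -/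
def IsJet (u : JetSpace d J b) (g : Eucl d → ℝ) : Prop :=
  ∀ k : MultiIdx d J, u k =ᵐ[weightedVolume d b] multiD (fun i => (k.1 i : ℕ)) g

lemma IsJet.sub {u v : JetSpace d J b} {f g : Eucl d → ℝ} (hu : IsJet u f) (hv : IsJet v g)
    (hf : ContDiff ℝ (⊤ : ℕ∞) f) (hg : ContDiff ℝ (⊤ : ℕ∞) g) :
    IsJet (u - v) (fun x => f x - g x) := by
  intro k
  rw [multiD_sub _ hf hg]
  exact (Lp.coeFn_sub _ _).trans ((hu k).sub (hv k))

lemma IsJet.const_smul {u : JetSpace d J b} {f : Eucl d → ℝ} (hu : IsJet u f)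
    (hf : ContDiff ℝ (⊤ : ℕ∞) f) (c : ℝ) : IsJet (c • u) (fun x => c • f x) := by
  intro k
  rw [multiD_const_smul _ c hf]
  exact (Lp.coeFn_smul _ _).trans ((hu k).const_smul c)

lemma exists_isJet (h : d < 2 * b) {g : Eucl d → ℝ} {K : ℝ} (hg : ContDiff ℝ (⊤ : ℕ∞) g)
    (hK : BddDeriv J K g) : ∃ u : JetSpace d J b, IsJet u g := by
  have := isFiniteMeasure_weightedVolume h
  have hm : ∀ k : MultiIdx d J,
      MemLp (multiD (fun i => (k.1 i : ℕ)) g) 2 (weightedVolume d b) := fun k =>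
    MemLp.of_bound ((hasFormalAdjoint_multiD _).1 g hg).continuous.aestronglyMeasurable K
      (ae_of_all _ fun x => (norm_multiD_le _ hg x).trans (hK _ k.2 x))
  exact ⟨WithLp.toLp 2 fun k => (hm k).toLp _, fun k => (hm k).coeFn_toLp⟩

lemma exists_norm_le_of_isJet (J : ℕ) (h : d < 2 * b) : ∃ C : ℝ, 0 ≤ C ∧
    ∀ {u : JetSpace d J b} {g : Eucl d → ℝ} {K : ℝ}, ContDiff ℝ (⊤ : ℕ∞) g → BddDeriv J K g →
      IsJet u g → ‖u‖ ≤ C * K := by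
  have := isFiniteMeasure_weightedVolume h
  set A : ℝ := (measureUnivNNReal (weightedVolume d b) : ℝ) ^ (2 : ℝ≥0∞).toReal⁻¹ with hA
  have hA0 : 0 ≤ A := by positivity
  refine ⟨√(Fintype.card (MultiIdx d J)) * A, by positivity, fun {u g K} hg hK hu => ?_⟩
  have hK0 := hK.nonneg
  rw [PiLp.norm_eq_of_L2]
  refine Real.sqrt_le_iff.2 ⟨by positivity, ?_⟩
  calc ∑ k, ‖u k‖ ^ 2 ≤ ∑ k : MultiIdx d J, (A * K) ^ 2 := by
        refine Finset.sum_le_sum fun k _ => ?_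
        gcongr
        refine Lp.norm_le_of_ae_bound hK0 ?_
        filter_upwards [hu k] with x hx
        rw [hx]
        exact (norm_multiD_le _ hg x).trans (hK _ k.2 x)
    _ = _ := by
        rw [Finset.sum_const, Finset.card_univ, nsmul_eq_mul, mul_assoc, mul_pow (√_),
          Real.sq_sqrt (Nat.cast_nonneg _)]

/-- Dominated convergence: the constant `K ^ 2` is integrable for the finite weighted measure.
Uniform `C^J` bounds and pointwise convergence of derivatives thus suffice for convergence in norm.
-/
lemma tendsto_zero_of_isJet {ι : Type*} {l : Filter ι} [l.IsCountablyGenerated] (h : d < 2 * b)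
    {u : ι → JetSpace d J b} {g : ι → Eucl d → ℝ} {K : ℝ}
    (hg : ∀ i, ContDiff ℝ (⊤ : ℕ∞) (g i)) (hK : ∀ i, BddDeriv J K (g i))
    (hu : ∀ i, IsJet (u i) (g i))
    (hlim : ∀ m ≤ J, ∀ w, Tendsto (fun i => ‖iteratedFDeriv ℝ m (g i) w‖) l (𝓝 0)) :
    Tendsto u l (𝓝 0) := by
  have := isFiniteMeasure_weightedVolume h
  rw [tendsto_zero_iff_norm_tendsto_zero]
  simp_rw [PiLp.norm_eq_of_L2]
  suffices hk : ∀ k : MultiIdx d J, Tendsto (fun i => ‖u i k‖ ^ 2) l (𝓝 0) by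
    simpa using (tendsto_finsetSum Finset.univ fun k _ => hk k).sqrt
  intro k
  have e : ∀ i, ‖u i k‖ ^ 2 =
      ∫ x, (multiD (fun j => (k.1 j : ℕ)) (g i) x) ^ 2 ∂weightedVolume d b := fun i => by
    rw [← real_inner_self_eq_norm_sq, L2.inner_def]
    refine integral_congr_ae ?_
    filter_upwards [hu i k] with x hx
    rw [hx, real_inner_self_eq_norm_sq, Real.norm_eq_abs, sq_abs]
  simp_rw [e]
  rw [← integral_zero (Eucl d) ℝ (μ := weightedVolume d b)]
  refine tendsto_integral_filter_of_dominated_convergence (fun _ => K ^ 2)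
    (Eventually.of_forall fun i => ?_) (Eventually.of_forall fun i => ae_of_all _ fun x => ?_)
    (integrable_const _) (ae_of_all _ fun x => ?_)
  · exact (((hasFormalAdjoint_multiD _).1 _ (hg i)).continuous.pow 2).aestronglyMeasurable
  · rw [norm_pow]
    gcongr
    exact (norm_multiD_le _ (hg i) x).trans (hK i _ k.2 x)
  · rw [show (0 : ℝ) = 0 ^ 2 by norm_num]
    refine Tendsto.pow ?_ 2
    rw [tendsto_zero_iff_norm_tendsto_zero]
    exact squeeze_zero (fun _ => norm_nonneg _) (fun i => norm_multiD_le _ (hg i) x)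
      (hlim _ k.2 x)

/-! ### An element of `H^{J,b}` is determined by its function -/

/-- Unweighted pairing with `φ` is the weighted inner product with `(1 + ‖x‖ ^ (2 * b)) * φ`, which
is square integrable by compact support. -/
lemma exists_clm_eq_integral_mul {φ : Eucl d → ℝ} (hφ : Continuous φ) (hφ' : HasCompactSupport φ) :
    ∃ Λ : Lp ℝ 2 (weightedVolume d b) →L[ℝ] ℝ, ∀ f, Λ f = ∫ x, f x * φ x := by
  have hm : MemLp (fun x => (1 + ‖x‖ ^ (2 * b)) * φ x) 2 (weightedVolume d b) := by
    have hc : Continuous fun x => (1 + ‖x‖ ^ (2 * b)) * φ x :=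
      (contDiff_weight b).continuous.mul hφ
    have hs : HasCompactSupport fun x => (1 + ‖x‖ ^ (2 * b)) * φ x := hφ'.mul_left
    have : IsLocallyFiniteMeasure (weightedVolume d b) :=
      IsLocallyFiniteMeasure.withDensity_ofReal (contDiff_weight_inv b).continuous
    exact hc.memLp_of_hasCompactSupport hs
  refine ⟨innerSL ℝ (hm.toLp _), fun f => ?_⟩
  rw [innerSL_apply_apply, L2.inner_def]
  have : ∫ x, inner ℝ (hm.toLp _ x) (f x) ∂weightedVolume d b =
      ∫ x, f x * ((1 + ‖x‖ ^ (2 * b)) * φ x) ∂weightedVolume d b := by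
    refine integral_congr_ae ?_
    filter_upwards [hm.coeFn_toLp] with x hx
    rw [hx]
    simp
  rw [this, integral_weightedVolume]
  refine integral_congr_ae (ae_of_all _ fun x => ?_)
  have := (weight_pos b x).ne'
  simp only
  field_simp

/-- Integration by parts `∫ u_k φ = ∫ u_0 ψ` holds for jets of test functions, and both sides are
continuous in the jet, so it passes to the closure. All components are therefore weak derivatives of
`u_0` and vanish with it. -/
lemma eq_zero_of_toFun_ae_eq_zero (h : d < 2 * b) {u : WSobolev d J b}
    (hu : u.toFun =ᵐ[volume] 0) : u = 0 := by
  have := isFiniteMeasure_weightedVolume h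
  have key : ∀ (k : MultiIdx d J) (φ : Eucl d → ℝ), ContDiff ℝ (⊤ : ℕ∞) φ →
      HasCompactSupport φ → ∫ x, u.1 k x * φ x = 0 := by
    intro k φ hφ hφ'
    obtain ⟨ψ, hψ, hψ', hadj⟩ := (hasFormalAdjoint_multiD fun i => (k.1 i : ℕ)).2 φ hφ hφ'
    obtain ⟨Λ, hΛ⟩ := exists_clm_eq_integral_mul (b := b) hφ.continuous hφ'
    obtain ⟨Λ', hΛ'⟩ := exists_clm_eq_integral_mul (b := b) hψ.continuous hψ'
    let pr := fun k : MultiIdx d J => PiLp.proj (𝕜 := ℝ) 2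
      (fun _ : MultiIdx d J => Lp ℝ 2 (weightedVolume d b)) k
    let Ψ : JetSpace d J b →L[ℝ] ℝ := Λ.comp (pr k) - Λ'.comp (pr (MultiIdx.zero d J))
    have hle : sobolevSubmodule d J b ≤ LinearMap.ker (Ψ : JetSpace d J b →ₗ[ℝ] ℝ) := by
      refine Submodule.topologicalClosure_minimal _ (Submodule.span_le.2 ?_) Ψ.isClosed_ker
      rintro v ⟨g, hg, hg', hv⟩
      have e : Ψ v = (∫ x, v k x * φ x) - ∫ x, v (MultiIdx.zero d J) x * ψ x := by
        rw [← hΛ, ← hΛ']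
        rfl
      have h0 := hv (MultiIdx.zero d J)
      have hz : multiD (fun i => ((MultiIdx.zero d J).1 i : ℕ)) g = g := multiD_zero g
      rw [hz] at h0
      change Ψ v = 0
      rw [e, sub_eq_zero]
      calc _ = ∫ x, multiD (fun i => (k.1 i : ℕ)) g x * φ x := by
            refine integral_congr_ae ?_
            filter_upwards [absolutelyContinuous_weightedVolume.ae_eq (hv k)] with x hx
            rw [hx]
        _ = ∫ x, g x * ψ x := hadj g hg
        _ = _ := by
            refine integral_congr_ae ?_
            filter_upwards [absolutelyContinuous_weightedVolume.ae_eq h0] with x hx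
            rw [hx]
    have h1 : Ψ u.1 = 0 := hle u.2
    have e : Ψ u.1 = (∫ x, u.1 k x * φ x) - ∫ x, u.1 (MultiIdx.zero d J) x * ψ x := by
      rw [← hΛ, ← hΛ']
      rfl
    rw [e, sub_eq_zero] at h1
    rw [h1]
    refine integral_eq_zero_of_ae ?_
    filter_upwards [hu] with x hx
    have hx' : u.1 (MultiIdx.zero d J) x = 0 := hx
    simp [hx']
  have hz : u.1 = 0 := by
    ext k : 1
    refine Lp.ext ?_
    refine EventuallyEq.trans ?_ (Lp.coeFn_zero _ _ _).symm
    refine ae_eq_zero_of_integral_contDiff_smul_eq_zero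
      (((Lp.memLp (u.1 k)).integrable (by norm_num)).locallyIntegrable) fun φ hφ hφ' => ?_
    -- Testing in the weighted measure is unweighted testing against the inverse weight times `φ`,
    -- still a smooth compactly supported function.
    rw [integral_weightedVolume, ← key k (fun x => (1 + ‖x‖ ^ (2 * b))⁻¹ * φ x)
      ((contDiff_weight_inv b).mul hφ) hφ'.mul_left]
    refine integral_congr_ae (ae_of_all _ fun x => ?_)
    simp only [smul_eq_mul]
    ring
  exact Subtype.ext hz

end

section

variable {d J b : ℕ}

/-! ### Functions of class `C_b^∞` as elements of `H^{J,b}` -/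

lemma exists_bddDeriv_of_forall {E F : Type*} [NormedAddCommGroup E] [NormedSpace ℝ E]
    [NormedAddCommGroup F] [NormedSpace ℝ F] {ι : Type*} {f : ι → E → F}
    (hf : ∀ m : ℕ, ∃ C : ℝ, ∀ i w, ‖iteratedFDeriv ℝ m (f i) w‖ ≤ C) (n : ℕ) :
    ∃ K, ∀ i, BddDeriv n K (f i) := by
  choose C hC using hf
  refine ⟨∑ m ∈ Finset.range (n + 1), |C m|, fun i m hm w => (hC m i w).trans ?_⟩
  exact (le_abs_self _).trans (Finset.single_le_sum (f := fun m => |C m|)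
    (fun _ _ => abs_nonneg _) (Finset.mem_range.2 (by omega)))

lemma IsCbInfty.exists_bddDeriv {f : Eucl d → ℝ} (hf : IsCbInfty f) (n : ℕ) :
    ∃ K, BddDeriv n K f := by
  obtain ⟨K, hK⟩ := exists_bddDeriv_of_forall (ι := Unit) (f := fun _ => f)
    (fun m => (hf.2 m).imp fun C hC _ => hC) n
  exact ⟨K, hK ()⟩

lemma isCbInfty_of_bddDeriv {f : Eucl d → ℝ} (hf : ContDiff ℝ (⊤ : ℕ∞) f)
    (h : ∀ n, ∃ K, BddDeriv n K f) : IsCbInfty f :=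
  ⟨hf, fun m => (h m).imp fun _ hK => hK m le_rfl⟩

lemma IsCbInfty.sub {f g : Eucl d → ℝ} (hf : IsCbInfty f) (hg : IsCbInfty g) :
    IsCbInfty fun w => f w - g w := by
  refine isCbInfty_of_bddDeriv (hf.1.sub hg.1) fun n => ?_
  obtain ⟨K, hK⟩ := hf.exists_bddDeriv n
  obtain ⟨L, hL⟩ := hg.exists_bddDeriv n
  exact ⟨_, hK.sub hL hf.1 hg.1⟩

lemma IsCbInfty.const_smul {f : Eucl d → ℝ} (hf : IsCbInfty f) (c : ℝ) :
    IsCbInfty fun w => c • f w := by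
  refine isCbInfty_of_bddDeriv (BddDeriv.contDiff_const_smul hf.1 c) fun n => ?_
  obtain ⟨K, hK⟩ := hf.exists_bddDeriv n
  exact ⟨_, hK.const_smul hf.1 c⟩

lemma isCbInfty_of_hasCompactSupport {f : Eucl d → ℝ} (hf : ContDiff ℝ (⊤ : ℕ∞) f)
    (hc : HasCompactSupport f) : IsCbInfty f :=
  ⟨hf, fun m => (hc.iteratedFDeriv m).exists_bound_of_continuous
    (hf.continuous_iteratedFDeriv (by exact_mod_cast le_top))⟩

/-- Dilating one bump, `χ(w / (i + 1))`, only shrinks its derivatives, whence a bound uniform in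
`i`. -/
lemma exists_cutoff (d n : ℕ) : ∃ (χ : ℕ → Eucl d → ℝ) (K : ℝ),
    (∀ i, ContDiff ℝ (⊤ : ℕ∞) (χ i)) ∧ (∀ i, HasCompactSupport (χ i)) ∧
    (∀ i, BddDeriv n K (χ i)) ∧ ∀ w, ∀ᶠ i in atTop, χ i =ᶠ[𝓝 w] 1 := by
  let χ : ContDiffBump (0 : Eucl d) := ⟨1, 2, by norm_num, by norm_num⟩
  have hχ : ContDiff ℝ (⊤ : ℕ∞) χ := χ.contDiff
  obtain ⟨K, hK⟩ := (isCbInfty_of_hasCompactSupport hχ χ.hasCompactSupport).exists_bddDeriv n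
  have hpos : ∀ i : ℕ, (0 : ℝ) < ((i : ℝ) + 1)⁻¹ := fun i => by positivity
  refine ⟨fun i w => χ (((i : ℝ) + 1)⁻¹ • w), K,
    fun i => hχ.comp (contDiff_const_smul _),
    fun i => χ.hasCompactSupport.comp_smul (hpos i).ne', fun i m hm w => ?_, fun w => ?_⟩
  · rw [iteratedFDeriv_comp_const_smul _ (hχ.of_le (by exact_mod_cast le_top)), norm_smul]
    have h1 : ‖(((i : ℝ) + 1)⁻¹) ^ m‖ ≤ 1 := by
      rw [Real.norm_of_nonneg (by positivity)]
      exact pow_le_one₀ (hpos i).le (inv_le_one_of_one_le₀ (by simp))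
    exact (mul_le_of_le_one_left (norm_nonneg _) h1).trans (hK m hm _)
  · obtain ⟨N, hN⟩ := exists_nat_gt ‖w‖
    filter_upwards [eventually_ge_atTop N] with i hi
    have hi' : ‖w‖ < (i : ℝ) + 1 := hN.trans_le (by exact_mod_cast hi.trans (Nat.le_succ i))
    filter_upwards [continuous_norm.continuousAt.eventually_lt
      (continuousAt_const (y := (i : ℝ) + 1)) hi'] with z hz
    refine χ.one_of_mem_closedBall ?_
    rw [mem_closedBall_zero_iff, norm_smul, Real.norm_of_nonneg (hpos i).le,
      inv_mul_le_iff₀ (by positivity)]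
    rw [show χ.rIn = 1 from rfl, mul_one]
    exact hz.le

/-- The truncations `χ_i g` are bounded in `C^J` uniformly in `i` and agree with `g` near any given
point for large `i`, so their jets converge to that of `g`. -/
lemma exists_wSobolev_isJet (J : ℕ) (h : d < 2 * b) {g : Eucl d → ℝ} (hg : IsCbInfty g) :
    ∃ u : WSobolev d J b, IsJet u.1 g := by
  obtain ⟨K, hK⟩ := hg.exists_bddDeriv J
  obtain ⟨χ, L, hχ, hχc, hL, hχ1⟩ := exists_cutoff d J
  obtain ⟨u, hu⟩ := exists_isJet h hg.1 hK
  have hs : ∀ i, ContDiff ℝ (⊤ : ℕ∞) fun w => χ i w * g w := fun i => (hχ i).mul hg.1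
  have hB : ∀ i, BddDeriv J (2 ^ J * (L * K)) fun w => χ i w * g w := fun i =>
    (hL i).bilinear (ContinuousLinearMap.mul ℝ ℝ) (ContinuousLinearMap.opNorm_mul_le ℝ ℝ) hK
      (hχ i) hg.1
  choose v hv using fun i => exists_isJet h (hs i) (hB i)
  have hlim : Tendsto (fun i => u - v i) atTop (𝓝 0) := by
    refine tendsto_zero_of_isJet h (fun i => hg.1.sub (hs i))
      (fun i => hK.sub (hB i) hg.1 (hs i)) (fun i => hu.sub (hv i) hg.1 (hs i))
      fun m _ w => ?_
    refine tendsto_const_nhds.congr' ?_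
    filter_upwards [hχ1 w] with i hi
    have : (fun w => g w - χ i w * g w) =ᶠ[𝓝 w] fun _ => 0 := by
      filter_upwards [hi] with z hz
      simp [hz]
    rw [(this.iteratedFDeriv ℝ m).eq_of_nhds]
    simp
  have hlim' : Tendsto v atTop (𝓝 u) := by
    simpa using (tendsto_const_nhds (x := u)).sub hlim
  refine ⟨⟨u, mem_closure_of_tendsto hlim' (Eventually.of_forall fun i => ?_)⟩, hu⟩
  exact Submodule.subset_span ⟨_, hs i, (hχc i).mul_right, hv i⟩

lemma IsJet.toFun_ae_eq {u : WSobolev d J b} {g : Eucl d → ℝ} (hu : IsJet u.1 g) :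
    u.toFun =ᵐ[volume] g := by
  have := absolutelyContinuous_weightedVolume.ae_eq (hu (MultiIdx.zero d J))
  rwa [show multiD (fun i => ((MultiIdx.zero d J).1 i : ℕ)) g = g from multiD_zero g] at this

/-- The choice hidden in `toSobolev` is harmless by `eq_zero_of_toFun_ae_eq_zero`; its linearity on
`C_b^∞` comes from here. -/
lemma IsJet.toSobolev_eq (h : d < 2 * b) {u : WSobolev d J b} {g : Eucl d → ℝ}
    (hu : IsJet u.1 g) : toSobolev J b g = u := by
  have hex : ∃ u : WSobolev d J b, u.toFun =ᵐ[volume] g := ⟨u, hu.toFun_ae_eq⟩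
  rw [toSobolev, dif_pos hex, ← sub_eq_zero]
  refine eq_zero_of_toFun_ae_eq_zero h ?_
  have h1 : (hex.choose - u).toFun =ᵐ[volume] hex.choose.toFun - u.toFun :=
    absolutelyContinuous_weightedVolume.ae_eq (Lp.coeFn_sub _ _)
  filter_upwards [h1, hex.choose_spec, hu.toFun_ae_eq] with x h1 h2 h3
  simp [h1, h2, h3]

lemma isJet_toSobolev (J : ℕ) (h : d < 2 * b) {g : Eucl d → ℝ} (hg : IsCbInfty g) :
    IsJet (toSobolev J b g).1 g := by
  obtain ⟨u, hu⟩ := exists_wSobolev_isJet J h hg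
  rwa [hu.toSobolev_eq h]

lemma toSobolev_sub (J : ℕ) (h : d < 2 * b) {f g : Eucl d → ℝ} (hf : IsCbInfty f)
    (hg : IsCbInfty g) :
    toSobolev J b (fun w => f w - g w) = toSobolev J b f - toSobolev J b g :=
  IsJet.toSobolev_eq h
    (IsJet.sub (isJet_toSobolev J h hf) (isJet_toSobolev J h hg) hf.1 hg.1)

lemma toSobolev_const_smul (J : ℕ) (h : d < 2 * b) {f : Eucl d → ℝ} (hf : IsCbInfty f)
    (c : ℝ) : toSobolev J b (fun w => c • f w) = c • toSobolev J b f :=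
  IsJet.toSobolev_eq h (IsJet.const_smul (isJet_toSobolev J h hf) hf.1 c)

lemma exists_norm_toSobolev_le (J : ℕ) (h : d < 2 * b) : ∃ C : ℝ, 0 ≤ C ∧
    ∀ {g : Eucl d → ℝ} {K : ℝ}, IsCbInfty g → BddDeriv J K g → ‖toSobolev J b g‖ ≤ C * K := by
  obtain ⟨C, hC, hC'⟩ := exists_norm_le_of_isJet J h
  exact ⟨C, hC, fun hg hK => hC' hg.1 hK (isJet_toSobolev J h hg)⟩

lemma tendsto_toSobolev {ι : Type*} {l : Filter ι} [l.IsCountablyGenerated] (J : ℕ)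
    (h : d < 2 * b) {g : ι → Eucl d → ℝ} {g₀ : Eucl d → ℝ} {K : ℝ} (hg : ∀ i, IsCbInfty (g i))
    (hg₀ : IsCbInfty g₀) (hK : ∀ i, BddDeriv J K (g i))
    (hlim : ∀ m ≤ J, ∀ w,
      Tendsto (fun i => ‖iteratedFDeriv ℝ m (fun z => g i z - g₀ z) w‖) l (𝓝 0)) :
    Tendsto (fun i => toSobolev J b (g i)) l (𝓝 (toSobolev J b g₀)) := by
  obtain ⟨L, hL⟩ := hg₀.exists_bddDeriv J
  have h1 : Tendsto (fun i => (toSobolev J b (g i)).1 - (toSobolev J b g₀).1) l (𝓝 0) :=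
    tendsto_zero_of_isJet h (fun i => (hg i).1.sub hg₀.1)
      (fun i => (hK i).sub hL (hg i).1 hg₀.1)
      (fun i => (isJet_toSobolev J h (hg i)).sub (isJet_toSobolev J h hg₀) (hg i).1 hg₀.1) hlim
  rw [tendsto_subtype_rng]
  simpa using h1.add_const (toSobolev J b g₀).1

/-- Continuous functions that agree almost everywhere are equal. This lets the fluctuation equation,
stated through `rep`, be tested with a given `C_b^∞` function. -/
lemma rep_toSobolev (J : ℕ) (h : d < 2 * b) {g : Eucl d → ℝ} (hg : IsCbInfty g) :
    (toSobolev J b g).rep = g := by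
  have hae := (isJet_toSobolev J h hg).toFun_ae_eq
  have hex : ∃ f : Eucl d → ℝ, Continuous f ∧ (toSobolev J b g).toFun =ᵐ[volume] f :=
    ⟨g, hg.1.continuous, hae⟩
  rw [WSobolev.rep, dif_pos hex]
  exact (Continuous.ae_eq_iff_eq volume hex.choose_spec.1 hg.1.continuous).1
    (hex.choose_spec.2.symm.trans hae)

/-- Density of `C_c^∞`. The Hahn–Banach extension of `Φ` to the whole jet space has a closed kernel
there, to which the minimality of the topological closure applies. -/
lemma dual_eq_zero_of_forall_toSobolev (h : d < 2 * b) {Φ : WSobolevDual d J b}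
    (hΦ : ∀ g : Eucl d → ℝ, IsCbInfty g → Φ (toSobolev J b g) = 0) : Φ = 0 := by
  obtain ⟨Ψ, hΨ, -⟩ := exists_extension_norm_eq (sobolevSubmodule d J b) Φ
  have hle : sobolevSubmodule d J b ≤ LinearMap.ker (Ψ : JetSpace d J b →ₗ[ℝ] ℝ) := by
    refine Submodule.topologicalClosure_minimal _ (Submodule.span_le.2 ?_) Ψ.isClosed_ker
    rintro v ⟨g, hg, hg', hv⟩
    let u : WSobolev d J b :=
      ⟨v, subset_closure (Submodule.subset_span ⟨g, hg, hg', hv⟩)⟩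
    have hu : toSobolev J b g = u := IsJet.toSobolev_eq h hv
    have h1 := hΦ g (isCbInfty_of_hasCompactSupport hg hg')
    rw [hu, ← hΨ] at h1
    exact h1
  ext u
  rw [← hΨ]
  exact hle u.2

end

/-! ### Gradients -/

section

variable {d n : ℕ}

/-- The Riesz isomorphism, as a linear isometry. -/
def rieszIso (d : ℕ) : StrongDual ℝ (Eucl d) ≃ₗᵢ[ℝ] Eucl d where
  toFun := (InnerProductSpace.toDual ℝ (Eucl d)).symm
  invFun := InnerProductSpace.toDual ℝ (Eucl d)
  map_add' := map_add _
  map_smul' c x := by simp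
  left_inv := (InnerProductSpace.toDual ℝ (Eucl d)).right_inv
  right_inv := (InnerProductSpace.toDual ℝ (Eucl d)).left_inv
  norm_map' := (InnerProductSpace.toDual ℝ (Eucl d)).symm.norm_map

lemma gradient_eq_rieszIso_comp (f : Eucl d → ℝ) : gradient f = rieszIso d ∘ fderiv ℝ f := rfl

lemma contDiff_gradient {f : Eucl d → ℝ} (hf : ContDiff ℝ (⊤ : ℕ∞) f) :
    ContDiff ℝ (⊤ : ℕ∞) (gradient f) := by
  rw [gradient_eq_rieszIso_comp]
  exact (rieszIso d).contDiff.comp (hf.fderiv_right (by simp))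

lemma norm_iteratedFDeriv_gradient (f : Eucl d → ℝ) (m : ℕ) (w : Eucl d) :
    ‖iteratedFDeriv ℝ m (gradient f) w‖ = ‖iteratedFDeriv ℝ (m + 1) f w‖ := by
  rw [gradient_eq_rieszIso_comp, LinearIsometryEquiv.norm_iteratedFDeriv_comp_left,
    norm_iteratedFDeriv_fderiv]

lemma BddDeriv.gradient {f : Eucl d → ℝ} {m : ℕ} {K : ℝ} (hf : BddDeriv (m + 1) K f) :
    BddDeriv m K (gradient f) := fun i hi w => by
  rw [norm_iteratedFDeriv_gradient]
  exact hf _ (by omega) w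

variable {𝒳 : Set (Eucl n)} {σ : Eucl d → 𝒳 → ℝ}

lemma gradDot_eq (σ : Eucl d → 𝒳 → ℝ) (f : Eucl d → ℝ) (x : 𝒳) :
    gradDot σ f x = fun w => fderiv ℝ f w (gradient (fun w' => σ w' x) w) := by
  ext w
  rw [gradDot, gradient, InnerProductSpace.toDual_symm_apply]

lemma IsSmoothActivation.exists_bddDeriv (hσ : IsSmoothActivation σ) (m : ℕ) :
    ∃ M : ℝ, 1 ≤ M ∧ ∀ x, BddDeriv m M fun w => σ w x := by
  obtain ⟨K, hK⟩ := exists_bddDeriv_of_forall (f := fun (x : 𝒳) w => σ w x)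
    (fun m => (hσ.bounded m).imp fun C hC x w => hC w x) m
  exact ⟨max 1 K, le_max_left _ _, fun x => (hK x).mono le_rfl (le_max_right _ _)⟩

lemma IsSmoothActivation.isCbInfty (hσ : IsSmoothActivation σ) (x : 𝒳) :
    IsCbInfty fun w => σ w x :=
  ⟨hσ.contDiff x, fun m => (hσ.bounded m).imp fun _ hC w => hC w x⟩

lemma IsSmoothActivation.exists_bddDeriv_gradDot (hσ : IsSmoothActivation σ) (m : ℕ) :
    ∃ M : ℝ, 0 ≤ M ∧ ∀ {f : Eucl d → ℝ} {K : ℝ}, ContDiff ℝ (⊤ : ℕ∞) f → BddDeriv (m + 1) K f →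
      ∀ x, BddDeriv m (M * K) (gradDot σ f x) := by
  obtain ⟨M, hM1, hM⟩ := hσ.exists_bddDeriv (m + 1)
  refine ⟨2 ^ m * M, by positivity, fun {f K} hf hK x => ?_⟩
  rw [gradDot_eq]
  refine (hK.fderiv.clm_apply (hM x).gradient (hf.fderiv_right (by simp))
    (contDiff_gradient (hσ.contDiff x))).mono le_rfl (le_of_eq (by ring))

lemma IsSmoothActivation.contDiff_gradDot (hσ : IsSmoothActivation σ) {f : Eucl d → ℝ}
    (hf : ContDiff ℝ (⊤ : ℕ∞) f) (x : 𝒳) : ContDiff ℝ (⊤ : ℕ∞) (gradDot σ f x) := by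
  rw [gradDot_eq]
  exact (hf.fderiv_right (m := (⊤ : ℕ∞)) (by simp)).clm_apply
    (contDiff_gradient (hσ.contDiff x))

lemma IsSmoothActivation.isCbInfty_gradDot (hσ : IsSmoothActivation σ) {f : Eucl d → ℝ}
    (hf : IsCbInfty f) (x : 𝒳) : IsCbInfty (gradDot σ f x) := by
  refine isCbInfty_of_bddDeriv (hσ.contDiff_gradDot hf.1 x) fun m => ?_
  obtain ⟨M, -, hM⟩ := hσ.exists_bddDeriv_gradDot m
  obtain ⟨K, hK⟩ := hf.exists_bddDeriv (m + 1)
  exact ⟨_, hM hf.1 hK x⟩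

/-! ### Continuity in the data point `x` -/

lemma IsSmoothActivation.tendsto_iteratedFDeriv_sub (hσ : IsSmoothActivation σ) (x₀ : 𝒳) (m : ℕ)
    (w : Eucl d) :
    Tendsto (fun x => ‖iteratedFDeriv ℝ m (fun z => σ z x - σ z x₀) w‖) (𝓝 x₀) (𝓝 0) := by
  have hc : Continuous fun x : 𝒳 => iteratedFDeriv ℝ m (fun z => σ z x) w :=
    (hσ.continuous m).comp (Continuous.prodMk_right w)
  have e : ∀ x, iteratedFDeriv ℝ m (fun z => σ z x - σ z x₀) w =
      iteratedFDeriv ℝ m (fun z => σ z x) w - iteratedFDeriv ℝ m (fun z => σ z x₀) w := fun x =>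
    iteratedFDeriv_sub_apply ((hσ.contDiff x).contDiffAt.of_le (by exact_mod_cast le_top))
      ((hσ.contDiff x₀).contDiffAt.of_le (by exact_mod_cast le_top))
  simp_rw [e]
  have := (hc.sub
    (continuous_const (y := iteratedFDeriv ℝ m (fun z => σ z x₀) w))).norm.tendsto x₀
  simpa using this

/-- The difference is `∇f · ∇(σ(·, x) - σ(·, x₀))`; the Leibniz rule reduces it to derivatives of
`σ(·, x) - σ(·, x₀)` of order at most `m + 1`. -/
lemma IsSmoothActivation.tendsto_iteratedFDeriv_gradDot_sub (hσ : IsSmoothActivation σ)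
    {f : Eucl d → ℝ} (hf : ContDiff ℝ (⊤ : ℕ∞) f) (x₀ : 𝒳) (m : ℕ) (w : Eucl d) :
    Tendsto (fun x => ‖iteratedFDeriv ℝ m (fun z => gradDot σ f x z - gradDot σ f x₀ z) w‖)
      (𝓝 x₀) (𝓝 0) := by
  have hs : ∀ x, ContDiff ℝ (⊤ : ℕ∞) fun z => σ z x - σ z x₀ := fun x =>
    (hσ.contDiff x).sub (hσ.contDiff x₀)
  have e : ∀ x, (fun z => gradDot σ f x z - gradDot σ f x₀ z) = fun z =>
      ContinuousLinearMap.id ℝ (Eucl d →L[ℝ] ℝ) (fderiv ℝ f z)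
        (gradient (fun w => σ w x - σ w x₀) z) := by
    intro x
    ext z
    have hg : gradient (fun w => σ w x - σ w x₀) z =
        gradient (fun w => σ w x) z - gradient (fun w => σ w x₀) z := by
      rw [gradient, gradient, gradient, ← map_sub]
      congr 1
      exact fderiv_sub (((hσ.contDiff x).differentiable (by simp)) z)
        (((hσ.contDiff x₀).differentiable (by simp)) z)
    rw [gradDot_eq, gradDot_eq, hg]
    simp
  have hb : ∀ x, ‖iteratedFDeriv ℝ m (fun z => gradDot σ f x z - gradDot σ f x₀ z) w‖ ≤
      ∑ j ∈ Finset.range (m + 1), (m.choose j : ℝ) * ‖iteratedFDeriv ℝ j (fderiv ℝ f) w‖ *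
        ‖iteratedFDeriv ℝ (m - j + 1) (fun z => σ z x - σ z x₀) w‖ := by
    intro x
    rw [e x]
    simp_rw [← norm_iteratedFDeriv_gradient]
    exact ContinuousLinearMap.norm_iteratedFDeriv_le_of_bilinear_of_le_one _
      (hf.fderiv_right (m := (⊤ : ℕ∞)) (by simp)) (contDiff_gradient (hs x)) w
      (by exact_mod_cast le_top) ContinuousLinearMap.norm_id_le
  refine squeeze_zero (fun _ => norm_nonneg _) hb ?_
  simpa using tendsto_finsetSum (Finset.range (m + 1)) fun j _ =>
    (hσ.tendsto_iteratedFDeriv_sub x₀ (m - j + 1) w).const_mul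
      ((m.choose j : ℝ) * ‖iteratedFDeriv ℝ j (fderiv ℝ f) w‖)

variable {J b : ℕ}

lemma IsSmoothActivation.continuous_toSobolev (hσ : IsSmoothActivation σ) (J : ℕ)
    (h : d < 2 * b) : Continuous fun x : 𝒳 => toSobolev J b fun w => σ w x := by
  obtain ⟨M, -, hM⟩ := hσ.exists_bddDeriv J
  exact continuous_iff_continuousAt.2 fun x₀ => tendsto_toSobolev J h hσ.isCbInfty
    (hσ.isCbInfty x₀) hM fun m _ w => hσ.tendsto_iteratedFDeriv_sub x₀ m w

lemma IsSmoothActivation.continuous_toSobolev_gradDot (hσ : IsSmoothActivation σ) (J : ℕ)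
    (h : d < 2 * b) {f : Eucl d → ℝ} (hf : IsCbInfty f) :
    Continuous fun x : 𝒳 => toSobolev J b (gradDot σ f x) := by
  obtain ⟨M, -, hM⟩ := hσ.exists_bddDeriv_gradDot J
  obtain ⟨K, hK⟩ := hf.exists_bddDeriv (J + 1)
  exact continuous_iff_continuousAt.2 fun x₀ => tendsto_toSobolev J h (hσ.isCbInfty_gradDot hf)
    (hσ.isCbInfty_gradDot hf x₀) (hM hf.1 hK)
    fun m _ w => hσ.tendsto_iteratedFDeriv_gradDot_sub hf.1 x₀ m w

lemma tendsto_apply_of_iteratedFDeriv_zero {g : 𝒳 → Eucl d → ℝ} {x₀ : 𝒳} {w : Eucl d}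
    (h : Tendsto (fun x => ‖iteratedFDeriv ℝ 0 (fun z => g x z - g x₀ z) w‖) (𝓝 x₀) (𝓝 0)) :
    ContinuousAt (fun x => g x w) x₀ := by
  simp_rw [norm_iteratedFDeriv_zero] at h
  rw [ContinuousAt]
  simpa using (tendsto_zero_iff_norm_tendsto_zero.2 h).add_const (g x₀ w)

lemma IsSmoothActivation.continuous_integral (hσ : IsSmoothActivation σ)
    (ν : ProbabilityMeasure (Eucl d)) :
    Continuous fun x : 𝒳 => ∫ w, σ w x ∂(ν : Measure (Eucl d)) := by
  obtain ⟨M, -, hM⟩ := hσ.exists_bddDeriv 0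
  exact continuous_of_dominated (bound := fun _ => M)
    (fun x => (hσ.contDiff x).continuous.aestronglyMeasurable)
    (fun x => ae_of_all _ fun w => (hM x).norm_le w) (integrable_const _)
    (ae_of_all _ fun w => continuous_iff_continuousAt.2 fun x₀ =>
      tendsto_apply_of_iteratedFDeriv_zero (hσ.tendsto_iteratedFDeriv_sub x₀ 0 w))

lemma IsSmoothActivation.continuous_integral_gradDot (hσ : IsSmoothActivation σ)
    {f : Eucl d → ℝ} (hf : IsCbInfty f) (ν : ProbabilityMeasure (Eucl d)) :
    Continuous fun x : 𝒳 => ∫ w, gradDot σ f x w ∂(ν : Measure (Eucl d)) := by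
  obtain ⟨M, -, hM⟩ := hσ.exists_bddDeriv_gradDot 0
  obtain ⟨K, hK⟩ := hf.exists_bddDeriv 1
  exact continuous_of_dominated (bound := fun _ => M * K)
    (fun x => (hσ.contDiff_gradDot hf.1 x).continuous.aestronglyMeasurable)
    (fun x => ae_of_all _ fun w => (hM hf.1 hK x).norm_le w) (integrable_const _)
    (ae_of_all _ fun w => continuous_iff_continuousAt.2 fun x₀ =>
      tendsto_apply_of_iteratedFDeriv_zero
        (hσ.tendsto_iteratedFDeriv_gradDot_sub hf.1 x₀ 0 w))

lemma BddDeriv.norm_integral_le {g : Eucl d → ℝ} {m : ℕ} {K : ℝ} (hg : BddDeriv m K g)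
    (ν : ProbabilityMeasure (Eucl d)) : ‖∫ w, g w ∂(ν : Measure (Eucl d))‖ ≤ K := by
  simpa using norm_integral_le_of_norm_le_const (μ := (ν : Measure (Eucl d)))
    (ae_of_all _ hg.norm_le)

/-! ### Continuity for the Wasserstein distance -/

/-- The easy half of Kantorovich–Rubinstein duality: any coupling bounds the difference of the
integrals. `L ≠ 0` allows `L` to pass through the infimum, which is `∞` if there is no coupling. -/
lemma enorm_integral_sub_integral_le {g : Eucl d → ℝ} (hg : IsCbInfty g) {L : ℝ≥0}
    (hL0 : L ≠ 0) (hL : LipschitzWith L g) (μ ν : ProbabilityMeasure (Eucl d)) :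
    ‖(∫ w, g w ∂(μ : Measure (Eucl d))) - ∫ w, g w ∂(ν : Measure (Eucl d))‖ₑ ≤
      L * wasserstein1 (μ : Measure (Eucl d)) ν := by
  have hL0' : (L : ℝ≥0∞) ≠ 0 := by simpa using hL0
  rw [wasserstein1, ENNReal.mul_iInf_of_ne hL0' ENNReal.coe_ne_top]
  refine le_iInf fun ρ => ?_
  rw [ENNReal.mul_iInf_of_ne hL0' ENNReal.coe_ne_top]
  refine le_iInf fun hρ => ?_
  have hp : IsProbabilityMeasure ρ := by
    refine ⟨?_⟩
    rw [← Set.preimage_univ (f := Prod.fst), ← Measure.map_apply measurable_fst .univ, hρ.1]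
    exact measure_univ
  obtain ⟨K, hK⟩ := hg.exists_bddDeriv 0
  have hc := hg.1.continuous
  have h1 : Integrable (fun p : Eucl d × Eucl d => g p.1) ρ :=
    Integrable.of_bound (hc.comp continuous_fst).aestronglyMeasurable K
      (ae_of_all _ fun p => hK.norm_le _)
  have h2 : Integrable (fun p : Eucl d × Eucl d => g p.2) ρ :=
    Integrable.of_bound (hc.comp continuous_snd).aestronglyMeasurable K
      (ae_of_all _ fun p => hK.norm_le _)
  rw [← hρ.1, ← hρ.2, integral_map measurable_fst.aemeasurable hc.aestronglyMeasurable,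
    integral_map measurable_snd.aemeasurable hc.aestronglyMeasurable, ← integral_sub h1 h2]
  refine (enorm_integral_le_lintegral_enorm _).trans ?_
  rw [← lintegral_const_mul' _ _ ENNReal.coe_ne_top]
  refine lintegral_mono fun p => ?_
  rw [← edist_eq_enorm_sub]
  exact hL p.1 p.2

lemma continuous_integral_of_wasserstein1 {μ : ℝ≥0 → ProbabilityMeasure (Eucl d)}
    (hμ : ∀ t, Tendsto (fun s => wasserstein1 (μ s : Measure (Eucl d)) (μ t)) (𝓝 t) (𝓝 0))
    {g : Eucl d → ℝ} (hg : IsCbInfty g) :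
    Continuous fun s => ∫ w, g w ∂(μ s : Measure (Eucl d)) := by
  obtain ⟨K, hK⟩ := hg.exists_bddDeriv 1
  -- The `+ 1` makes the Lipschitz constant nonzero.
  have hL : LipschitzWith (K.toNNReal + 1) g := LipschitzWith.of_dist_le_mul fun x y => by
    rw [NNReal.coe_add, Real.coe_toNNReal _ hK.nonneg, dist_eq_norm, dist_eq_norm]
    exact (hK.mono le_rfl (by simp)).norm_sub_le hg.1 y x
  refine continuous_iff_continuousAt.2 fun t => ?_
  rw [ContinuousAt, tendsto_iff_edist_tendsto_0]
  have h0 := ENNReal.Tendsto.const_mul (a := ((K.toNNReal + 1 : ℝ≥0) : ℝ≥0∞)) (hμ t)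
    (Or.inr ENNReal.coe_ne_top)
  rw [mul_zero] at h0
  refine tendsto_of_tendsto_of_tendsto_of_le_of_le tendsto_const_nhds h0 (fun _ => zero_le)
    fun s => ?_
  simp only [edist_eq_enorm_sub]
  exact enorm_integral_sub_integral_le hg (by simp) hL _ _

end

section

variable {d n J b : ℕ} {𝒳 : Set (Eucl n)} {𝒴 : Set ℝ} {σ : Eucl d → 𝒳 → ℝ}

/-! ### The dual norm on `C_b^∞` -/

/-- The norm of `Φ` as a linear form on `C_b^∞` with the norm of `C^{J+2}`. -/
def dualNorm (Φ : WSobolevDual d J b) : ℝ :=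
  sSup {r | ∃ f : Eucl d → ℝ, IsCbInfty f ∧ BddDeriv (J + 2) 1 f ∧ r = |Φ (toSobolev J b f)|}

lemma bddDeriv_zero (m : ℕ) {K : ℝ} (hK : 0 ≤ K) : BddDeriv m K fun _ : Eucl d => (0 : ℝ) :=
  fun i _ w => by
    rw [iteratedFDeriv_fun_zero]
    simpa using hK

lemma isCbInfty_zero : IsCbInfty fun _ : Eucl d => (0 : ℝ) :=
  isCbInfty_of_bddDeriv contDiff_const fun m => ⟨0, bddDeriv_zero m le_rfl⟩

lemma dualNorm_le {Φ : WSobolevDual d J b} {N : ℝ}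
    (hN : ∀ f : Eucl d → ℝ, IsCbInfty f → BddDeriv (J + 2) 1 f → |Φ (toSobolev J b f)| ≤ N) :
    dualNorm Φ ≤ N := by
  refine csSup_le ⟨_, _, isCbInfty_zero, bddDeriv_zero _ zero_le_one, rfl⟩ ?_
  rintro r ⟨f, hf, hf1, rfl⟩
  exact hN f hf hf1

lemma exists_abs_apply_toSobolev_le (J : ℕ) (h : d < 2 * b) : ∃ C : ℝ, 0 ≤ C ∧
    ∀ (Φ : WSobolevDual d J b) {f : Eucl d → ℝ} {K : ℝ}, IsCbInfty f → BddDeriv J K f →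
      |Φ (toSobolev J b f)| ≤ C * K * ‖Φ‖ := by
  obtain ⟨C, hC, hC'⟩ := exists_norm_toSobolev_le J h
  refine ⟨C, hC, fun Φ f K hf hK => ?_⟩
  rw [mul_comm]
  exact (Φ.le_opNorm _).trans (mul_le_mul_of_nonneg_left (hC' hf hK) (norm_nonneg _))

/-- The unit ball of `C^{J+2}` is bounded in `H^{J,b}`, so the supremum is taken over a bounded set
and is not the default value of `sSup`. -/
lemma abs_apply_le_dualNorm (h : d < 2 * b) (Φ : WSobolevDual d J b) {f : Eucl d → ℝ}
    (hf : IsCbInfty f) (hf1 : BddDeriv (J + 2) 1 f) : |Φ (toSobolev J b f)| ≤ dualNorm Φ := by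
  obtain ⟨C, hC, hC'⟩ := exists_abs_apply_toSobolev_le J h
  refine le_csSup ⟨C * 1 * ‖Φ‖, ?_⟩ ⟨f, hf, hf1, rfl⟩
  rintro r ⟨g, hg, hg1, rfl⟩
  exact hC' Φ hg (hg1.mono (by omega) le_rfl)

lemma abs_apply_le_dualNorm_mul (h : d < 2 * b) (Φ : WSobolevDual d J b) {f : Eucl d → ℝ} {K : ℝ}
    (hf : IsCbInfty f) (hK : 0 < K) (hfK : BddDeriv (J + 2) K f) :
    |Φ (toSobolev J b f)| ≤ dualNorm Φ * K := by
  have h1 := abs_apply_le_dualNorm h Φ (hf.const_smul K⁻¹)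
    ((hfK.const_smul hf.1 K⁻¹).mono le_rfl
      (le_of_eq (by rw [abs_of_pos (inv_pos.2 hK), inv_mul_cancel₀ hK.ne'])))
  rw [toSobolev_const_smul J h hf, map_smul, smul_eq_mul, abs_mul, abs_of_pos (inv_pos.2 hK),
    inv_mul_le_iff₀ hK] at h1
  rwa [mul_comm]

lemma dualNorm_nonneg (h : d < 2 * b) (Φ : WSobolevDual d J b) : 0 ≤ dualNorm Φ :=
  (abs_nonneg _).trans (abs_apply_le_dualNorm h Φ isCbInfty_zero (bddDeriv_zero _ zero_le_one))

/-- Shows that `dualNorm` is Lipschitz for the norm of `H^{-J,b}`, hence continuous along a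
solution. -/
lemma exists_dualNorm_le_add (J : ℕ) (h : d < 2 * b) : ∃ C : ℝ, 0 ≤ C ∧
    ∀ Φ Ψ : WSobolevDual d J b, dualNorm Φ ≤ dualNorm Ψ + C * ‖Φ - Ψ‖ := by
  obtain ⟨C, hC, hC'⟩ := exists_abs_apply_toSobolev_le J h
  refine ⟨C, hC, fun Φ Ψ => dualNorm_le fun f hf hf1 => ?_⟩
  have h1 := hC' (Φ - Ψ) hf (hf1.mono (by omega) le_rfl)
  have h2 := abs_apply_le_dualNorm h Ψ hf hf1
  rw [mul_one] at h1
  calc |Φ (toSobolev J b f)| = |Ψ (toSobolev J b f) + (Φ - Ψ) (toSobolev J b f)| := by simp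
    _ ≤ _ := (abs_add_le _ _).trans (add_le_add h2 h1)

lemma eq_zero_of_dualNorm_le_zero (h : d < 2 * b) {Φ : WSobolevDual d J b}
    (hΦ : dualNorm Φ ≤ 0) : Φ = 0 := by
  refine dual_eq_zero_of_forall_toSobolev h fun g hg => ?_
  obtain ⟨K, hK⟩ := hg.exists_bddDeriv (J + 2)
  have hK0 : 0 < K + 1 := by linarith [hK.nonneg]
  have h1 := abs_apply_le_dualNorm_mul h Φ hg hK0 (hK.mono le_rfl (by linarith))
  rw [← abs_nonpos_iff]
  exact h1.trans (mul_nonpos_of_nonpos_of_nonneg hΦ hK0.le)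

/-- Composition with `w ↦ w + c ∇σ(w, x)` is a contraction up to `1 + O(c)`, and it agrees with
`f + c ∇f · ∇σ(·, x)` to the first order. -/
lemma IsSmoothActivation.exists_abs_add_mul_gradDot_le (hσ : IsSmoothActivation σ) (J : ℕ)
    (h : d < 2 * b) : ∃ C : ℝ, 0 ≤ C ∧ ∀ (Φ : WSobolevDual d J b) {f : Eucl d → ℝ},
      IsCbInfty f → BddDeriv (J + 2) 1 f → ∀ (x : 𝒳) (c : ℝ),
      |Φ (toSobolev J b f) + c * Φ (toSobolev J b (gradDot σ f x))| ≤
        (1 + C * |c|) * dualNorm Φ + C * c ^ 2 * ‖Φ‖ := by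
  have hbound : ∀ m : ℕ, ∃ M : ℝ, ∀ x, BddDeriv m M (gradient fun w => σ w x) := fun m =>
    (hσ.exists_bddDeriv (m + 1)).imp fun M hM x => (hM.2 x).gradient
  obtain ⟨M₁, hM₁⟩ := hbound (J + 2 + 1)
  obtain ⟨C₁, hC₁, hs⟩ := BddDeriv.shift (E := Eucl d) M₁ (J + 2)
  obtain ⟨M₂, hM₂⟩ := hbound (J + 1)
  obtain ⟨C₂, hC₂, hr⟩ := BddDeriv.shift_sub_sub (E := Eucl d) M₂ J
  obtain ⟨C₃, hC₃, hT⟩ := exists_abs_apply_toSobolev_le J h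
  obtain ⟨M₄, hM₄, hG⟩ := hσ.exists_bddDeriv_gradDot J
  -- `C₁` is the growth of the `C^{J+2}` norm under composition, `C₃ * C₂` the Taylor remainder seen
  -- by `Φ`, and `C₃ * M₄` serves for `|c| > 1`.
  refine ⟨C₁ + C₃ * C₂ + C₃ * M₄, by positivity, fun Φ f hf hf1 x c => ?_⟩
  have hN := dualNorm_nonneg h Φ
  have hu := contDiff_gradient (hσ.contDiff x)
  -- The composition estimates need `|c| ≤ 1`. Otherwise `|c| ≤ c ^ 2`, and the crude bound of the
  -- gradient term fits into the quadratic error. Both cases occur because `c` will be proportional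
  -- to the unbounded label `y`.
  rcases le_or_gt |c| 1 with hc | hc
  · set S : Eucl d → ℝ := fun w => f (w + c • gradient (fun w => σ w x) w) with hS
    have hSs : ContDiff ℝ (⊤ : ℕ∞) S := BddDeriv.contDiff_shift hf.1 hu c
    have hSb : IsCbInfty S := isCbInfty_of_bddDeriv hSs fun m => by
      obtain ⟨M, hM⟩ := hbound (m + 1)
      obtain ⟨C, -, hC⟩ := BddDeriv.shift (E := Eucl d) M m
      obtain ⟨K, hK⟩ := hf.exists_bddDeriv m
      exact ⟨_, hC hf.1 hu (hM x) hc hK⟩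
    have hD := hσ.isCbInfty_gradDot hf x
    have h1 := hs hf.1 hu (hM₁ x) hc hf1
    have h2 := hr hf.1 hu (hM₂ x) hc hf1
    rw [mul_one] at h1 h2
    have hpos : 0 < 1 + C₁ * |c| := by positivity
    have h3 := abs_apply_le_dualNorm_mul h Φ hSb hpos h1
    have hR : IsCbInfty fun w => S w - f w - c • gradDot σ f x w :=
      (hSb.sub hf).sub (hD.const_smul c)
    have h4 := hT Φ hR (K := C₂ * c ^ 2) (by rw [gradDot_eq]; exact h2)
    have e : toSobolev J b (fun w => S w - f w - c • gradDot σ f x w) =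
        toSobolev J b S - toSobolev J b f - c • toSobolev J b (gradDot σ f x) := by
      rw [toSobolev_sub J h (hSb.sub hf) (hD.const_smul c), toSobolev_sub J h hSb hf,
        toSobolev_const_smul J h hD]
    rw [e] at h4
    -- Here `f + c ∇f · ∇σ` is the composition `S` minus its Taylor remainder: `S` is measured by
    -- `dualNorm`, the remainder by `‖Φ‖`.
    calc |Φ (toSobolev J b f) + c * Φ (toSobolev J b (gradDot σ f x))|
        = |Φ (toSobolev J b S) - Φ (toSobolev J b S - toSobolev J b f -
            c • toSobolev J b (gradDot σ f x))| := by
          congr 1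
          simp only [map_sub, map_smul, smul_eq_mul]
          ring
      _ ≤ dualNorm Φ * (1 + C₁ * |c|) + C₃ * (C₂ * c ^ 2) * ‖Φ‖ :=
          (abs_sub _ _).trans (add_le_add h3 h4)
      _ = (1 + C₁ * |c|) * dualNorm Φ + (C₃ * C₂) * c ^ 2 * ‖Φ‖ := by ring
      _ ≤ _ := by
          have : 0 ≤ C₃ * C₂ := by positivity
          have : 0 ≤ C₃ * M₄ := by positivity
          gcongr <;> linarith
  · have h1 := abs_apply_le_dualNorm h Φ hf hf1
    have h2 := hT Φ (hσ.isCbInfty_gradDot hf x)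
      (hG hf.1 (hf1.mono (m := J + 1) (by omega) le_rfl) x)
    rw [mul_one] at h2
    have hc2 : |c| ≤ c ^ 2 := by
      rw [← sq_abs]
      nlinarith
    calc |Φ (toSobolev J b f) + c * Φ (toSobolev J b (gradDot σ f x))|
        ≤ |Φ (toSobolev J b f)| + |c| * |Φ (toSobolev J b (gradDot σ f x))| := by
          rw [← abs_mul]
          exact abs_add_le _ _
      _ ≤ dualNorm Φ + c ^ 2 * (C₃ * M₄ * ‖Φ‖) := by gcongr
      _ = (1 + 0 * |c|) * dualNorm Φ + (C₃ * M₄) * c ^ 2 * ‖Φ‖ := by ring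
      _ ≤ _ := by
          have : 0 ≤ C₃ * C₂ := by positivity
          gcongr
          · positivity
          · linarith

/-! ### The two terms of the drift -/

/-- `∫ α (y - ⟨σ(·,x), ν⟩) ⟨∇f · ∇σ(·,x), Φ⟩ π(dx,dy)`. -/
def transportTerm (σ : Eucl d → 𝒳 → ℝ) (α : ℝ) (π : Measure (𝒳 × 𝒴))
    (ν : ProbabilityMeasure (Eucl d)) (Φ : WSobolevDual d J b) (f : Eucl d → ℝ) : ℝ :=
  ∫ p : 𝒳 × 𝒴, α * ((p.2 : ℝ) - ∫ w, σ w p.1 ∂(ν : Measure (Eucl d))) *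
    bracket (gradDot σ f p.1) Φ ∂π

/-- `∫ α ⟨σ(·,x), Φ⟩ ⟨∇f · ∇σ(·,x), ν⟩ π(dx,dy)`. -/
def nonlocalTerm (σ : Eucl d → 𝒳 → ℝ) (α : ℝ) (π : Measure (𝒳 × 𝒴))
    (ν : ProbabilityMeasure (Eucl d)) (Φ : WSobolevDual d J b) (f : Eucl d → ℝ) : ℝ :=
  ∫ p : 𝒳 × 𝒴, α * bracket (fun w => σ w p.1) Φ *
    ∫ w, gradDot σ f p.1 w ∂(ν : Measure (Eucl d)) ∂π

variable {π : Measure (𝒳 × 𝒴)} [IsProbabilityMeasure π]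

lemma continuous_transportTerm_integrand (hσ : IsSmoothActivation σ) (α : ℝ) (h : d < 2 * b)
    {f : Eucl d → ℝ} (hf : IsCbInfty f) (ν : ProbabilityMeasure (Eucl d))
    (Φ : WSobolevDual d J b) : Continuous fun p : 𝒳 × 𝒴 =>
      α * ((p.2 : ℝ) - ∫ w, σ w p.1 ∂(ν : Measure (Eucl d))) * bracket (gradDot σ f p.1) Φ :=
  (continuous_const.mul ((continuous_subtype_val.comp continuous_snd).sub
    ((hσ.continuous_integral ν).comp continuous_fst))).mul
      (Φ.continuous.comp ((hσ.continuous_toSobolev_gradDot J h hf).comp continuous_fst))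

lemma continuous_nonlocalTerm_integrand (hσ : IsSmoothActivation σ) (α : ℝ) (h : d < 2 * b)
    {f : Eucl d → ℝ} (hf : IsCbInfty f) (ν : ProbabilityMeasure (Eucl d))
    (Φ : WSobolevDual d J b) : Continuous fun p : 𝒳 × 𝒴 =>
      α * bracket (fun w => σ w p.1) Φ * ∫ w, gradDot σ f p.1 w ∂(ν : Measure (Eucl d)) :=
  (continuous_const.mul (Φ.continuous.comp
    ((hσ.continuous_toSobolev J h).comp continuous_fst))).mul
      ((hσ.continuous_integral_gradDot hf ν).comp continuous_fst)

lemma exists_abs_transportTerm_integrand_le (hσ : IsSmoothActivation σ) (α : ℝ) (J : ℕ)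
    (h : d < 2 * b) : ∃ C : ℝ, 0 ≤ C ∧ ∀ (ν : ProbabilityMeasure (Eucl d))
      (Φ : WSobolevDual d J b) {f : Eucl d → ℝ} {K : ℝ}, IsCbInfty f → BddDeriv (J + 1) K f →
      ∀ p : 𝒳 × 𝒴, |α * ((p.2 : ℝ) - ∫ w, σ w p.1 ∂(ν : Measure (Eucl d))) *
        bracket (gradDot σ f p.1) Φ| ≤ C * K * ‖Φ‖ * (1 + |(p.2 : ℝ)|) := by
  obtain ⟨M, hM1, hM⟩ := hσ.exists_bddDeriv 0
  obtain ⟨C₃, hC₃, hT⟩ := exists_abs_apply_toSobolev_le J h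
  obtain ⟨M₄, hM₄, hG⟩ := hσ.exists_bddDeriv_gradDot J
  refine ⟨|α| * M * (C₃ * M₄), by positivity, fun ν Φ f K hf hK p => ?_⟩
  have h1 := hT Φ (hσ.isCbInfty_gradDot hf p.1) (hG hf.1 hK p.1)
  have h2 : |(p.2 : ℝ) - ∫ w, σ w p.1 ∂(ν : Measure (Eucl d))| ≤ M * (1 + |(p.2 : ℝ)|) := by
    have h3 : |∫ w, σ w p.1 ∂(ν : Measure (Eucl d))| ≤ M := (hM p.1).norm_integral_le ν
    have h4 : |(p.2 : ℝ)| ≤ M * |(p.2 : ℝ)| := le_mul_of_one_le_left (abs_nonneg _) hM1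
    linarith [abs_sub (p.2 : ℝ) (∫ w, σ w p.1 ∂(ν : Measure (Eucl d)))]
  rw [abs_mul, abs_mul]
  calc _ ≤ |α| * (M * (1 + |(p.2 : ℝ)|)) * (C₃ * (M₄ * K) * ‖Φ‖) := by
        refine mul_le_mul (by gcongr) h1 (abs_nonneg _) (by positivity)
    _ = _ := by ring

lemma integrable_transportTerm_integrand (hσ : IsSmoothActivation σ) (α : ℝ) (h : d < 2 * b)
    (hy : Integrable (fun p : 𝒳 × 𝒴 => |(p.2 : ℝ)|) π)
    {f : Eucl d → ℝ} (hf : IsCbInfty f) (ν : ProbabilityMeasure (Eucl d))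
    (Φ : WSobolevDual d J b) : Integrable (fun p : 𝒳 × 𝒴 =>
      α * ((p.2 : ℝ) - ∫ w, σ w p.1 ∂(ν : Measure (Eucl d))) * bracket (gradDot σ f p.1) Φ) π := by
  obtain ⟨C, -, hC⟩ := exists_abs_transportTerm_integrand_le (𝒴 := 𝒴) hσ α J h
  obtain ⟨K, hK⟩ := hf.exists_bddDeriv (J + 1)
  exact (((integrable_const 1).add hy).const_mul (C * K * ‖Φ‖)).mono'
    (continuous_transportTerm_integrand hσ α h hf ν Φ).aestronglyMeasurable
    (ae_of_all _ fun p => hC ν Φ hf hK p)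

/-- No derivative is lost: `Φ` meets only `σ(·, x)`, bounded in `C^{J+2}` uniformly in `x`, so the
weak norm `dualNorm Φ` suffices. -/
lemma exists_abs_nonlocalTerm_integrand_le (hσ : IsSmoothActivation σ) (α : ℝ) (J : ℕ)
    (h : d < 2 * b) : ∃ C : ℝ, 0 ≤ C ∧ ∀ (ν : ProbabilityMeasure (Eucl d))
      (Φ : WSobolevDual d J b) {f : Eucl d → ℝ} {K : ℝ}, IsCbInfty f → BddDeriv 1 K f →
      ∀ x : 𝒳, |α * bracket (fun w => σ w x) Φ *
        ∫ w, gradDot σ f x w ∂(ν : Measure (Eucl d))| ≤ C * K * dualNorm Φ := by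
  obtain ⟨M, hM1, hM⟩ := hσ.exists_bddDeriv (J + 2)
  obtain ⟨M₄, hM₄, hG⟩ := hσ.exists_bddDeriv_gradDot 0
  refine ⟨|α| * M * M₄, by positivity, fun ν Φ f K hf hK x => ?_⟩
  have h1 : |bracket (fun w => σ w x) Φ| ≤ dualNorm Φ * M :=
    abs_apply_le_dualNorm_mul h Φ (hσ.isCbInfty x) (by linarith) (hM x)
  have h2 : |∫ w, gradDot σ f x w ∂(ν : Measure (Eucl d))| ≤ M₄ * K :=
    (hG hf.1 hK x).norm_integral_le ν
  have hN := dualNorm_nonneg h Φ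
  rw [abs_mul, abs_mul]
  calc _ ≤ |α| * (dualNorm Φ * M) * (M₄ * K) := by gcongr
    _ = _ := by ring

lemma integrable_nonlocalTerm_integrand (hσ : IsSmoothActivation σ) (α : ℝ) (h : d < 2 * b)
    {f : Eucl d → ℝ} (hf : IsCbInfty f) (ν : ProbabilityMeasure (Eucl d))
    (Φ : WSobolevDual d J b) : Integrable (fun p : 𝒳 × 𝒴 =>
      α * bracket (fun w => σ w p.1) Φ * ∫ w, gradDot σ f p.1 w ∂(ν : Measure (Eucl d))) π := by
  obtain ⟨C, -, hC⟩ := exists_abs_nonlocalTerm_integrand_le hσ α J h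
  obtain ⟨K, hK⟩ := hf.exists_bddDeriv 1
  exact Integrable.of_bound (continuous_nonlocalTerm_integrand hσ α h hf ν Φ).aestronglyMeasurable
    (C * K * dualNorm Φ) (ae_of_all _ fun p => hC ν Φ hf hK p.1)

lemma transportTerm_sub (hσ : IsSmoothActivation σ) (α : ℝ) (h : d < 2 * b)
    (hy : Integrable (fun p : 𝒳 × 𝒴 => |(p.2 : ℝ)|) π)
    {f : Eucl d → ℝ} (hf : IsCbInfty f) (ν : ProbabilityMeasure (Eucl d))
    (Φ Ψ : WSobolevDual d J b) : transportTerm σ α π ν (Φ - Ψ) f =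
      transportTerm σ α π ν Φ f - transportTerm σ α π ν Ψ f := by
  rw [transportTerm, transportTerm, transportTerm,
    ← integral_sub (integrable_transportTerm_integrand hσ α h hy hf ν Φ)
      (integrable_transportTerm_integrand hσ α h hy hf ν Ψ)]
  refine integral_congr_ae (ae_of_all _ fun p => ?_)
  simp only [bracket, sub_apply]
  ring

lemma nonlocalTerm_sub (hσ : IsSmoothActivation σ) (α : ℝ) (h : d < 2 * b)
    {f : Eucl d → ℝ} (hf : IsCbInfty f) (ν : ProbabilityMeasure (Eucl d))
    (Φ Ψ : WSobolevDual d J b) : nonlocalTerm σ α π ν (Φ - Ψ) f =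
      nonlocalTerm σ α π ν Φ f - nonlocalTerm σ α π ν Ψ f := by
  rw [nonlocalTerm, nonlocalTerm, nonlocalTerm,
    ← integral_sub (integrable_nonlocalTerm_integrand hσ α h hf ν Φ)
      (integrable_nonlocalTerm_integrand hσ α h hf ν Ψ)]
  refine integral_congr_ae (ae_of_all _ fun p => ?_)
  simp only [bracket, sub_apply]
  ring

/-- A crude bound by the strong norm, meant for the small increments `D s - D t`. -/
lemma exists_abs_transportTerm_le (hσ : IsSmoothActivation σ) (α : ℝ) (J : ℕ) (h : d < 2 * b)
    (hy : Integrable (fun p : 𝒳 × 𝒴 => |(p.2 : ℝ)|) π) : ∃ C : ℝ, 0 ≤ C ∧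
    ∀ (ν : ProbabilityMeasure (Eucl d)) (Φ : WSobolevDual d J b) {f : Eucl d → ℝ},
      IsCbInfty f → BddDeriv (J + 2) 1 f → |transportTerm σ α π ν Φ f| ≤ C * ‖Φ‖ := by
  obtain ⟨C, hC0, hC⟩ := exists_abs_transportTerm_integrand_le (𝒴 := 𝒴) hσ α J h
  have hi := (integrable_const (1 : ℝ)).add hy
  refine ⟨C * ∫ p, (1 + |(p.2 : ℝ)|) ∂π,
    mul_nonneg hC0 (integral_nonneg fun p => by positivity), fun ν Φ f hf hf1 => ?_⟩
  rw [transportTerm, ← Real.norm_eq_abs]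
  refine (norm_integral_le_of_norm_le (hi.const_mul (C * 1 * ‖Φ‖))
    (ae_of_all _ fun p => hC ν Φ hf (hf1.mono (by omega) le_rfl) p)).trans (le_of_eq ?_)
  rw [integral_const_mul]
  simp only [Pi.add_apply]
  ring

lemma exists_abs_nonlocalTerm_le (hσ : IsSmoothActivation σ) (α : ℝ) (π : Measure (𝒳 × 𝒴))
    [IsProbabilityMeasure π] (J : ℕ) (h : d < 2 * b) :
    ∃ C : ℝ, 0 ≤ C ∧ ∀ (ν : ProbabilityMeasure (Eucl d)) (Φ : WSobolevDual d J b)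
      {f : Eucl d → ℝ}, IsCbInfty f → BddDeriv (J + 2) 1 f →
      |nonlocalTerm σ α π ν Φ f| ≤ C * dualNorm Φ := by
  obtain ⟨C, hC0, hC⟩ := exists_abs_nonlocalTerm_integrand_le hσ α J h
  refine ⟨C, hC0, fun ν Φ f hf hf1 => ?_⟩
  rw [nonlocalTerm, ← Real.norm_eq_abs]
  refine (norm_integral_le_of_norm_le_const (C := C * 1 * dualNorm Φ)
    (ae_of_all _ fun p => hC ν Φ hf (hf1.mono (by omega) le_rfl) p.1)).trans (le_of_eq ?_)
  simp

/-- The main estimate: an explicit Euler step for the transport term increases the dual norm by a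
factor `1 + O(r)` at most, up to an error `O(r²)`. -/
lemma exists_abs_add_mul_transportTerm_le (hσ : IsSmoothActivation σ) (α : ℝ) (J : ℕ)
    (h : d < 2 * b) (hy : Integrable (fun p : 𝒳 × 𝒴 => |(p.2 : ℝ)|) π)
    (hy2 : Integrable (fun p : 𝒳 × 𝒴 => |(p.2 : ℝ)| ^ 2) π) : ∃ C : ℝ, 0 ≤ C ∧
    ∀ (ν : ProbabilityMeasure (Eucl d)) (Φ : WSobolevDual d J b) {f : Eucl d → ℝ},
      IsCbInfty f → BddDeriv (J + 2) 1 f → ∀ r : ℝ, 0 ≤ r →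
      |Φ (toSobolev J b f) + r * transportTerm σ α π ν Φ f| ≤
        (1 + C * r) * dualNorm Φ + C * r ^ 2 * ‖Φ‖ := by
  obtain ⟨C, hC0, hC⟩ := hσ.exists_abs_add_mul_gradDot_le J h
  obtain ⟨M, hM1, hM⟩ := hσ.exists_bddDeriv 0
  -- `Y p` bounds `|α (y - ⟨σ(·, x), ν⟩)|`; its first moment yields the growth rate and its second
  -- moment the quadratic error.
  let Y : 𝒳 × 𝒴 → ℝ := fun p => |α| * (M + |(p.2 : ℝ)|)
  have hY : Integrable Y π := ((integrable_const M).add hy).const_mul |α|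
  have hY2 : Integrable (fun p => Y p ^ 2) π := by
    have : (fun p => Y p ^ 2) = fun p : 𝒳 × 𝒴 =>
        |α| ^ 2 * (M ^ 2 + 2 * M * |(p.2 : ℝ)| + |(p.2 : ℝ)| ^ 2) := by
      ext p
      simp only [Y]
      ring
    rw [this]
    exact ((((integrable_const (M ^ 2)).add (hy.const_mul (2 * M)))).add hy2).const_mul _
  have hY0 : ∀ p, 0 ≤ Y p := fun p => by positivity
  have hm1 : 0 ≤ ∫ p, Y p ∂π := integral_nonneg hY0
  have hm2 : 0 ≤ ∫ p, Y p ^ 2 ∂π := integral_nonneg fun p => sq_nonneg _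
  refine ⟨C * (∫ p, Y p ∂π) + C * ∫ p, Y p ^ 2 ∂π, by positivity,
    fun ν Φ f hf hf1 r hr => ?_⟩
  have hN := dualNorm_nonneg h Φ
  have hint := integrable_transportTerm_integrand hσ α h hy hf ν Φ
  -- As `π` has mass one, `Φ(f)` goes under the integral, and each data point contributes its own
  -- Euler step with `c = r α (y - ⟨σ(·, x), ν⟩)`.
  have e : Φ (toSobolev J b f) + r * transportTerm σ α π ν Φ f =
      ∫ p : 𝒳 × 𝒴, (Φ (toSobolev J b f) +
        r * (α * ((p.2 : ℝ) - ∫ w, σ w p.1 ∂(ν : Measure (Eucl d))) *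
          bracket (gradDot σ f p.1) Φ)) ∂π := by
    rw [integral_add (integrable_const _) (hint.const_mul r), integral_const_mul]
    simp [transportTerm]
  have hb₁ : Integrable (fun p => dualNorm Φ + C * r * dualNorm Φ * Y p) π :=
    (integrable_const _).add (hY.const_mul _)
  have hb : Integrable (fun p => dualNorm Φ + C * r * dualNorm Φ * Y p +
      C * r ^ 2 * ‖Φ‖ * Y p ^ 2) π := hb₁.add (hY2.const_mul _)
  rw [e, ← Real.norm_eq_abs]
  refine (norm_integral_le_of_norm_le hb (ae_of_all _ fun p => ?_)).trans ?_
  · have h2 : |r * (α * ((p.2 : ℝ) - ∫ w, σ w p.1 ∂(ν : Measure (Eucl d))))| ≤ r * Y p := by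
      have h3 : |∫ w, σ w p.1 ∂(ν : Measure (Eucl d))| ≤ M := (hM p.1).norm_integral_le ν
      rw [abs_mul, abs_mul, abs_of_nonneg hr]
      simp only [Y]
      gcongr
      linarith [abs_sub (p.2 : ℝ) (∫ w, σ w p.1 ∂(ν : Measure (Eucl d)))]
    have h1 := hC Φ hf hf1 p.1 (r * (α * ((p.2 : ℝ) - ∫ w, σ w p.1 ∂(ν : Measure (Eucl d)))))
    rw [mul_assoc r] at h1
    refine h1.trans ?_
    rw [← sq_abs (r * _)]
    calc _ ≤ (1 + C * (r * Y p)) * dualNorm Φ + C * (r * Y p) ^ 2 * ‖Φ‖ := by gcongr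
      _ = _ := by ring
  · rw [integral_add hb₁ (hY2.const_mul _),
      integral_add (integrable_const _) (hY.const_mul _), integral_const_mul _ Y,
      integral_const_mul _ fun p => Y p ^ 2]
    simp only [integral_const, probReal_univ, one_smul]
    have h1 : 0 ≤ C * (∫ p, Y p ∂π) * (r ^ 2 * ‖Φ‖) := by positivity
    have h2 : 0 ≤ C * (∫ p, Y p ^ 2 ∂π) * (r * dualNorm Φ) := by positivity
    nlinarith

end

/-! ### Continuity in time and the Grönwall argument -/

lemma continuous_norm_dual {X E : Type*} [TopologicalSpace X] [NormedAddCommGroup E]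
    [NormedSpace ℝ E] {D : X → StrongDual ℝ E} (hD : Continuous D) : Continuous fun s => ‖D s‖ :=
  continuous_norm.comp hD

lemma continuous_norm_sub_dual {X E : Type*} [TopologicalSpace X] [NormedAddCommGroup E]
    [NormedSpace ℝ E] {D : X → StrongDual ℝ E} (hD : Continuous D) (Φ : StrongDual ℝ E) :
    Continuous fun s => ‖D s - Φ‖ :=
  continuous_norm_dual (hD.sub continuous_const)

section

variable {d n J b : ℕ} {𝒳 : Set (Eucl n)} {𝒴 : Set ℝ} {σ : Eucl d → 𝒳 → ℝ}
  {π : Measure (𝒳 × 𝒴)} [IsProbabilityMeasure π]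

lemma continuous_transportTerm (hσ : IsSmoothActivation σ) (α : ℝ) (h : d < 2 * b)
    (hy : Integrable (fun p : 𝒳 × 𝒴 => |(p.2 : ℝ)|) π)
    {μ : ℝ≥0 → ProbabilityMeasure (Eucl d)}
    (hμ : ∀ g : Eucl d → ℝ, IsCbInfty g → Continuous fun s => ∫ w, g w ∂(μ s : Measure (Eucl d)))
    {f : Eucl d → ℝ} (hf : IsCbInfty f) (D : C(ℝ≥0, WSobolevDual d J b)) :
    Continuous fun s => transportTerm σ α π (μ s) (D s) f := by
  obtain ⟨C, hC0, hC⟩ := exists_abs_transportTerm_integrand_le (𝒴 := 𝒴) hσ α J h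
  obtain ⟨K, hK⟩ := hf.exists_bddDeriv (J + 1)
  have hK0 := hK.nonneg
  refine continuous_iff_continuousAt.2 fun t => ?_
  refine continuousAt_of_dominated
    (bound := fun p : 𝒳 × 𝒴 => C * K * (‖D t‖ + 1) * (1 + |(p.2 : ℝ)|))
    (Eventually.of_forall fun s =>
      (continuous_transportTerm_integrand hσ α h hf (μ s) (D s)).aestronglyMeasurable) ?_
    (((integrable_const 1).add hy).const_mul _) (ae_of_all _ fun p => ?_)
  · filter_upwards [((continuous_norm_dual D.continuous).continuousAt (x := t)).eventually_lt
      (continuousAt_const (y := ‖D t‖ + 1)) (lt_add_one _)] with s hs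
    refine ae_of_all _ fun p => (hC (μ s) (D s) hf hK p).trans ?_
    gcongr
  · exact ((continuous_const.mul (continuous_const.sub (hμ _ (hσ.isCbInfty p.1)))).mul
      (D.continuous.clm_apply continuous_const)).continuousAt

lemma continuous_nonlocalTerm (hσ : IsSmoothActivation σ) (α : ℝ) (π : Measure (𝒳 × 𝒴))
    [IsProbabilityMeasure π] (h : d < 2 * b)
    {μ : ℝ≥0 → ProbabilityMeasure (Eucl d)}
    (hμ : ∀ g : Eucl d → ℝ, IsCbInfty g → Continuous fun s => ∫ w, g w ∂(μ s : Measure (Eucl d)))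
    {f : Eucl d → ℝ} (hf : IsCbInfty f) (D : C(ℝ≥0, WSobolevDual d J b)) :
    Continuous fun s => nonlocalTerm σ α π (μ s) (D s) f := by
  obtain ⟨C, hC0, hC⟩ := exists_abs_nonlocalTerm_integrand_le hσ α J h
  obtain ⟨C', hC0', hC'⟩ := exists_dualNorm_le_add J h
  obtain ⟨K, hK⟩ := hf.exists_bddDeriv 1
  have hK0 := hK.nonneg
  refine continuous_iff_continuousAt.2 fun t => ?_
  refine continuousAt_of_dominated
    (bound := fun _ : 𝒳 × 𝒴 => C * K * (dualNorm (D t) + C' * 1))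
    (Eventually.of_forall fun s =>
      (continuous_nonlocalTerm_integrand hσ α h hf (μ s) (D s)).aestronglyMeasurable) ?_
    (integrable_const _) (ae_of_all _ fun p => ?_)
  · filter_upwards [((continuous_norm_sub_dual D.continuous (D t)).continuousAt
      (x := t)).eventually_lt (continuousAt_const (y := (1 : ℝ)))
        (by rw [sub_self, ContinuousLinearMap.opNorm_zero]; exact one_pos)] with s hs
    refine ae_of_all _ fun p => (hC (μ s) (D s) hf hK p.1).trans ?_
    have := (hC' (D s) (D t)).trans
      (add_le_add le_rfl (mul_le_mul_of_nonneg_left hs.le hC0'))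
    gcongr
  · exact ((continuous_const.mul (D.continuous.clm_apply continuous_const)).mul
      (hμ _ (hσ.isCbInfty_gradDot hf p.1))).continuousAt

/-- One step of the Grönwall argument. -/
lemma exists_dualNorm_step_le (hσ : IsSmoothActivation σ) (α : ℝ) (h : d < 2 * b)
    (hy : Integrable (fun p : 𝒳 × 𝒴 => |(p.2 : ℝ)|) π)
    (hy2 : Integrable (fun p : 𝒳 × 𝒴 => |(p.2 : ℝ)| ^ 2) π)
    {μ : ℝ≥0 → ProbabilityMeasure (Eucl d)}
    (hμ : ∀ g : Eucl d → ℝ, IsCbInfty g → Continuous fun s => ∫ w, g w ∂(μ s : Measure (Eucl d)))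
    (D : C(ℝ≥0, WSobolevDual d J b))
    (hD : ∀ f : Eucl d → ℝ, IsCbInfty f → ∀ t : ℝ≥0, D t (toSobolev J b f) =
      ∫ s in (0 : ℝ)..t, (transportTerm σ α π (μ s.toNNReal) (D s.toNNReal) f -
        nonlocalTerm σ α π (μ s.toNNReal) (D s.toNNReal) f)) :
    ∃ C : ℝ, 0 ≤ C ∧ ∀ (t z : ℝ≥0) (ε : ℝ), t < z →
      (∀ s : ℝ≥0, t ≤ s → s ≤ z → ‖D s - D t‖ ≤ ε) →
      dualNorm (D z) ≤ dualNorm (D t) +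
        (z - t) * (C * dualNorm (D t) + C * (z - t) * ‖D t‖ + C * ε) := by
  obtain ⟨C₁, hC₁, h1⟩ := exists_abs_add_mul_transportTerm_le hσ α J h hy hy2
  obtain ⟨C₂, hC₂, h2⟩ := exists_abs_transportTerm_le hσ α J h hy
  obtain ⟨C₃, hC₃, h3⟩ := exists_abs_nonlocalTerm_le hσ α π J h
  obtain ⟨C₄, hC₄, h4⟩ := exists_dualNorm_le_add J h
  refine ⟨C₁ + C₂ + C₃ + C₃ * C₄, by positivity, fun t z ε htz hε => ?_⟩
  have hε0 : 0 ≤ ε := (norm_nonneg (D t - D t)).trans (hε t le_rfl htz.le)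
  have htz' : (t : ℝ) < z := by exact_mod_cast htz
  have hr : 0 < (z : ℝ) - t := by linarith
  set r : ℝ := z - t with hrdef
  have hN := dualNorm_nonneg h (D t)
  refine dualNorm_le fun f hf hf1 => ?_
  set F : ℝ → ℝ := fun s => transportTerm σ α π (μ s.toNNReal) (D s.toNNReal) f -
    nonlocalTerm σ α π (μ s.toNNReal) (D s.toNNReal) f with hF
  have hFc : Continuous F :=
    ((continuous_transportTerm hσ α h hy hμ hf D).sub
      (continuous_nonlocalTerm hσ α π h hμ hf D)).comp continuous_real_toNNReal
  have e1 : D z (toSobolev J b f) = D t (toSobolev J b f) + ∫ s in (t : ℝ)..z, F s := by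
    rw [hD f hf z, hD f hf t, intervalIntegral.integral_add_adjacent_intervals
      (hFc.intervalIntegrable _ _) (hFc.intervalIntegrable _ _)]
  -- Averaging over `[t, z]`: after multiplication by `r = z - t`, every integrand is an Euler step
  -- of full length `r`, to which the main estimate applies before integrating.
  have e2 : r * D z (toSobolev J b f) =
      ∫ s in (t : ℝ)..z, (D t (toSobolev J b f) + r * F s) := by
    have hi : IntervalIntegrable (fun s => r * F s) volume t z :=
      (continuous_const.mul hFc).intervalIntegrable _ _
    rw [intervalIntegral.integral_add intervalIntegrable_const hi, intervalIntegral.integral_const,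
      intervalIntegral.integral_const_mul, e1, smul_eq_mul]
    ring
  set X : ℝ := (1 + C₁ * r) * dualNorm (D t) + C₁ * r ^ 2 * ‖D t‖ + r * (C₂ * ε) +
    r * (C₃ * (dualNorm (D t) + C₄ * ε)) with hX
  have hb : ∀ s ∈ Set.uIoc (t : ℝ) z, ‖D t (toSobolev J b f) + r * F s‖ ≤ X := by
    intro s hs
    rw [Set.uIoc_of_le htz'.le] at hs
    have hs0 : (0 : ℝ) ≤ s := t.2.trans hs.1.le
    have hsε := hε s.toNNReal (NNReal.le_toNNReal_of_coe_le hs.1.le)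
      (Real.toNNReal_le_iff_le_coe.2 hs.2)
    set ν := μ s.toNNReal
    set Φ := D s.toNNReal
    have b1 := h1 ν (D t) hf hf1 r hr.le
    have b2 := (h2 ν (Φ - D t) hf hf1).trans (mul_le_mul_of_nonneg_left hsε hC₂)
    have b3 := (h3 ν Φ hf hf1).trans (mul_le_mul_of_nonneg_left
      ((h4 Φ (D t)).trans (add_le_add le_rfl (mul_le_mul_of_nonneg_left hsε hC₄))) hC₃)
    -- In the transport term `D` is frozen at time `t`, as the Euler step requires, and the
    -- increment costs `O(ε)`. The coefficient `ν` stays at time `s`, since the estimate is uniform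
    -- in `ν`.
    have e : D t (toSobolev J b f) + r * F s =
        (D t (toSobolev J b f) + r * transportTerm σ α π ν (D t) f) +
          r * transportTerm σ α π ν (Φ - D t) f - r * nonlocalTerm σ α π ν Φ f := by
      rw [transportTerm_sub hσ α h hy hf]
      simp only [hF]
      ring
    rw [e, Real.norm_eq_abs]
    refine (abs_sub _ _).trans (add_le_add ((abs_add_le _ _).trans (add_le_add b1 ?_)) ?_)
    · rw [abs_mul, abs_of_pos hr]
      gcongr
    · rw [abs_mul, abs_of_pos hr]
      gcongr
  have key := intervalIntegral.norm_integral_le_of_norm_le_const hb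
  rw [← e2, norm_mul, Real.norm_of_nonneg hr.le, abs_of_pos (by linarith : (0 : ℝ) < z - t),
    ← hrdef, mul_comm X, Real.norm_eq_abs] at key
  refine (le_of_mul_le_mul_left key hr).trans ?_
  -- These are the slack terms between the coefficients in `X` and the single constant `C₁ + C₂ + C₃
  -- + C₃ * C₄`.
  have p1 : 0 ≤ r * ((C₂ + C₃ * C₄) * dualNorm (D t)) := by positivity
  have p2 : 0 ≤ r * ((C₂ + C₃ + C₃ * C₄) * r * ‖D t‖) := by positivity
  have p3 : 0 ≤ r * ((C₁ + C₃) * ε) := by positivity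
  rw [hX]
  nlinarith

/-- Dividing the one-step bound by the step length bounds the upper right derivative of `dualNorm (D
s)` by `C * dualNorm (D s)`; Grönwall from the initial value `0` concludes. -/
lemma eq_zero_of_transport_equation (hσ : IsSmoothActivation σ) (α : ℝ) (h : d < 2 * b)
    (hy : Integrable (fun p : 𝒳 × 𝒴 => |(p.2 : ℝ)|) π)
    (hy2 : Integrable (fun p : 𝒳 × 𝒴 => |(p.2 : ℝ)| ^ 2) π)
    {μ : ℝ≥0 → ProbabilityMeasure (Eucl d)}
    (hμ : ∀ g : Eucl d → ℝ, IsCbInfty g → Continuous fun s => ∫ w, g w ∂(μ s : Measure (Eucl d)))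
    (D : C(ℝ≥0, WSobolevDual d J b))
    (hD : ∀ f : Eucl d → ℝ, IsCbInfty f → ∀ t : ℝ≥0, D t (toSobolev J b f) =
      ∫ s in (0 : ℝ)..t, (transportTerm σ α π (μ s.toNNReal) (D s.toNNReal) f -
        nonlocalTerm σ α π (μ s.toNNReal) (D s.toNNReal) f)) (t : ℝ≥0) : D t = 0 := by
  obtain ⟨C, hC0, hC⟩ := exists_dualNorm_step_le hσ α h hy hy2 hμ D hD
  obtain ⟨C', hC0', hC'⟩ := exists_dualNorm_le_add J h
  have hDc : Continuous fun s : ℝ => D s.toNNReal := D.continuous.comp continuous_real_toNNReal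
  have hcont : Continuous fun s : ℝ => dualNorm (D s.toNNReal) := by
    refine continuous_iff_continuousAt.2 fun s => ?_
    rw [ContinuousAt, tendsto_iff_dist_tendsto_zero]
    have hlim : Tendsto (fun z : ℝ => C' * ‖D z.toNNReal - D s.toNNReal‖) (𝓝 s) (𝓝 0) := by
      have := ((continuous_norm_sub_dual hDc (D s.toNNReal)).const_mul C').tendsto s
      rwa [sub_self, ContinuousLinearMap.opNorm_zero, mul_zero] at this
    refine squeeze_zero (fun _ => dist_nonneg) (fun z => ?_) hlim
    rw [Real.dist_eq, abs_sub_le_iff]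
    constructor
    · linarith [hC' (D z.toNNReal) (D s.toNNReal)]
    · have : ‖D z.toNNReal - D s.toNNReal‖ = ‖D s.toNNReal - D z.toNNReal‖ := by
        rw [← neg_sub, ContinuousLinearMap.opNorm_neg]
      rw [this]
      linarith [hC' (D s.toNNReal) (D z.toNNReal)]
  have hzero : dualNorm (D (0 : ℝ).toNNReal) ≤ 0 := by
    refine dualNorm_le fun f hf _ => ?_
    have := hD f hf 0
    simp only [NNReal.coe_zero, intervalIntegral.integral_same] at this
    simp [this]
  have hg := le_gronwallBound_of_liminf_deriv_right_le (a := 0) (b := t) (δ := 0) (K := C) (ε := 0)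
    (f' := fun s => C * dualNorm (D s.toNNReal)) hcont.continuousOn ?_ hzero
    (fun s _ => by simp) t ⟨t.2, le_rfl⟩
  · rw [gronwallBound_ε0] at hg
    refine eq_zero_of_dualNorm_le_zero h ?_
    simpa using hg
  · intro s hs r hr
    refine Eventually.frequently ?_
    set N := dualNorm (D s.toNNReal) with hN
    -- One `ε` bounds both the step length and the increment of `D`; it is chosen so small that the
    -- error terms fit below `r`, which exceeds `C * N`.
    have hlim : Tendsto (fun ε : ℝ => C * N + C * ε * ‖D s.toNNReal‖ + C * ε) (𝓝[>] 0)
        (𝓝 (C * N)) := by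
      have : Continuous fun ε : ℝ => C * N + C * ε * ‖D s.toNNReal‖ + C * ε := by fun_prop
      simpa using (this.tendsto 0).mono_left nhdsWithin_le_nhds
    obtain ⟨ε, hεr, hε0⟩ := ((hlim.eventually_lt_const hr).and self_mem_nhdsWithin).exists
    have hε0 : 0 < ε := hε0
    obtain ⟨δ, hδ, hδ'⟩ := Metric.continuousAt_iff.1
      ((continuous_norm_sub_dual hDc (D s.toNNReal)).continuousAt (x := s)) ε hε0
    have hI : Set.Ioo s (s + min δ ε) ∈ 𝓝[>] s := Ioo_mem_nhdsGT (by
      have := lt_min hδ hε0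
      linarith)
    filter_upwards [hI] with z hz
    have hs0 : 0 ≤ s := hs.1
    have hz0 : 0 ≤ z := hs0.trans hz.1.le
    have hz1 : z - s < δ := by linarith [hz.2, min_le_left δ ε]
    have hz2 : z - s < ε := by linarith [hz.2, min_le_right δ ε]
    have hzs : 0 < z - s := by linarith [hz.1]
    have key := hC s.toNNReal z.toNNReal ε
      ((Real.toNNReal_lt_toNNReal_iff (by linarith)).2 hz.1) fun q hq1 hq2 => by
        have h1 : s ≤ q := Real.toNNReal_le_iff_le_coe.1 hq1
        have h2 : (q : ℝ) ≤ z := by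
          rw [← Real.coe_toNNReal z hz0]
          exact_mod_cast hq2
        have h3 := hδ' (x := (q : ℝ)) (by
          rw [Real.dist_eq, abs_of_nonneg (by linarith)]
          linarith)
        rw [Real.toNNReal_coe, sub_self, ContinuousLinearMap.opNorm_zero, Real.dist_eq,
          sub_zero] at h3
        exact (le_abs_self _).trans h3.le
    rw [Real.coe_toNNReal _ hs0, Real.coe_toNNReal _ hz0] at key
    rw [inv_mul_lt_iff₀ hzs]
    have h4 : C * (z - s) * ‖D s.toNNReal‖ ≤ C * ε * ‖D s.toNNReal‖ := by gcongr
    have h5 : (z - s) * (C * N + C * (z - s) * ‖D s.toNNReal‖ + C * ε) < (z - s) * r :=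
      mul_lt_mul_of_pos_left (by linarith) hzs
    linarith

end

/-! ### Pathwise uniqueness -/

lemma two_mul_halfCeil_add_two_gt (d : ℕ) : d < 2 * (halfCeil d + 2) := by
  have h : (d : ℝ) / 2 ≤ halfCeil d := Nat.le_ceil _
  have h' : (d : ℝ) ≤ 2 * halfCeil d := by linarith
  have h'' : d ≤ 2 * halfCeil d := by exact_mod_cast h'
  omega

theorem mainTheorem5
    {d n : ℕ} (hd : 1 ≤ d) (hn : 1 ≤ n)
    {𝒳 : Set (Eucl n)} {𝒴 : Set ℝ}
    (σ : Eucl d → 𝒳 → ℝ) (hσ : IsSmoothActivation σ)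
    (α : ℝ)
    (π : Measure (𝒳 × 𝒴)) [IsProbabilityMeasure π]
    (hπ : Integrable (fun p : 𝒳 × 𝒴 => |(p.2 : ℝ)| ^ (16 * (4 * halfCeil d + 6))) π)
    (μ₀ : ProbabilityMeasure (Eucl d))
    (hμ₀ : ∃ K : Set (Eucl d), IsCompact K ∧ (μ₀ : Measure (Eucl d)) Kᶜ = 0)
    (μ : ℝ≥0 → ProbabilityMeasure (Eucl d)) (hμ : IsMeanFieldLimit σ α π μ₀ μ)
    {Ω' : Type*} [MeasurableSpace Ω'] (P' : Measure Ω') [IsProbabilityMeasure P']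
    (Binf : Ω' → ℕ) (hBinf : Measurable Binf) (hBinf_pos : ∀ᵐ ω' ∂P', 1 ≤ Binf ω')
    (J₀ j₀ : ℕ) (hJ₀ : 4 * halfCeil d + 8 ≤ J₀) (hj₀ : j₀ = halfCeil d + 2)
    {Ω : Type*} [MeasurableSpace Ω] (P : Measure Ω) [IsProbabilityMeasure P]
    (G : Ω → C(ℝ≥0, WSobolevDual d J₀ j₀))
    (hG : IsGProcess σ α π μ (∫ ω', 1 / (Binf ω' : ℝ) ∂P') P G)
    (ν : Ω → WSobolevDual d (J₀ - 1) j₀) (hν : Measurable ν)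
    (η₁ η₂ : Ω → C(ℝ≥0, WSobolevDual d (J₀ - 1) j₀))
    (hη₁ : IsFluctuationSolution σ α π μ P G η₁)
    (hη₂ : IsFluctuationSolution σ α π μ P G η₂)
    (h₁ : ∀ᵐ ω ∂P, η₁ ω 0 = ν ω) (h₂ : ∀ᵐ ω ∂P, η₂ ω 0 = ν ω) :
    ∀ᵐ ω ∂P, η₁ ω = η₂ ω := by
  have h : d < 2 * j₀ := hj₀ ▸ two_mul_halfCeil_add_two_gt d
  have hmoment : ∀ m ≤ 16 * (4 * halfCeil d + 6),
      Integrable (fun p : 𝒳 × 𝒴 => |(p.2 : ℝ)| ^ m) π := fun m hm => by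
    refine ((integrable_const (1 : ℝ)).add hπ).mono'
      ((measurable_subtype_coe.comp measurable_snd).norm.pow_const m).aestronglyMeasurable
      (ae_of_all _ fun p => ?_)
    rw [Real.norm_of_nonneg (by positivity)]
    simp only [Pi.add_apply]
    rcases le_total |(p.2 : ℝ)| 1 with hp | hp
    · have := pow_le_one₀ (n := m) (abs_nonneg _) hp
      have : 0 ≤ |(p.2 : ℝ)| ^ (16 * (4 * halfCeil d + 6)) := by positivity
      linarith
    · have := pow_le_pow_right₀ hp hm
      linarith
  have hy : Integrable (fun p : 𝒳 × 𝒴 => |(p.2 : ℝ)|) π := by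
    simpa using hmoment 1 (by omega)
  have hy2 := hmoment 2 (by omega)
  have hμc : ∀ g : Eucl d → ℝ, IsCbInfty g →
      Continuous fun s => ∫ w, g w ∂(μ s : Measure (Eucl d)) :=
    fun g hg => continuous_integral_of_wasserstein1 hμ.continuous hg
  -- From here on the argument is pathwise: `ω` is fixed, and the lemma is applied to the difference
  -- of the two paths with `J = J₀ - 1`.
  filter_upwards [hη₁.equation, hη₂.equation, h₁, h₂] with ω e₁ e₂ i₁ i₂
  have key := eq_zero_of_transport_equation hσ α h hy hy2 hμc
    ⟨fun t => η₁ ω t - η₂ ω t, (η₁ ω).continuous.sub (η₂ ω).continuous⟩ fun f hf t => ?_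
  · ext1 t
    exact sub_eq_zero.1 (key t)
  have hc : ∀ η : C(ℝ≥0, WSobolevDual d (J₀ - 1) j₀),
      (Continuous fun s : ℝ => transportTerm σ α π (μ s.toNNReal) (η s.toNNReal) f) ∧
      Continuous fun s : ℝ => nonlocalTerm σ α π (μ s.toNNReal) (η s.toNNReal) f := fun η =>
    ⟨(continuous_transportTerm hσ α h hy hμc hf η).comp continuous_real_toNNReal,
      (continuous_nonlocalTerm hσ α π h hμc hf η).comp continuous_real_toNNReal⟩
  have q₁ := e₁ (toSobolev J₀ j₀ f) t
  have q₂ := e₂ (toSobolev J₀ j₀ f) t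
  rw [rep_toSobolev J₀ h hf] at q₁ q₂
  rw [i₁] at q₁
  rw [i₂] at q₂
  change _ = (∫ s in (0 : ℝ)..t, transportTerm σ α π (μ s.toNNReal) (η₁ ω s.toNNReal) f) -
    (∫ s in (0 : ℝ)..t, nonlocalTerm σ α π (μ s.toNNReal) (η₁ ω s.toNNReal) f) + _ at q₁
  change _ = (∫ s in (0 : ℝ)..t, transportTerm σ α π (μ s.toNNReal) (η₂ ω s.toNNReal) f) -
    (∫ s in (0 : ℝ)..t, nonlocalTerm σ α π (μ s.toNNReal) (η₂ ω s.toNNReal) f) + _ at q₂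
  simp_rw [ContinuousMap.coe_mk, transportTerm_sub hσ α h hy hf, nonlocalTerm_sub hσ α h hf]
  have I : ∀ {F : ℝ → ℝ}, Continuous F → IntervalIntegrable F volume 0 t :=
    fun hF => hF.intervalIntegrable _ _
  rw [intervalIntegral.integral_sub ((I (hc _).1).sub (I (hc _).1))
      ((I (hc _).2).sub (I (hc _).2)),
    intervalIntegral.integral_sub (I (hc _).1) (I (hc _).1),
    intervalIntegral.integral_sub (I (hc _).2) (I (hc _).2)]
  simp only [bracket] at q₁ q₂
  rw [sub_apply]
  -- The common initial value `ν ω` and the common noise `G ω t` cancel in the difference of `q₁`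
  -- and `q₂`.
  linarith

end
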